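/- All vector spaces are over $\mathbb C$, $p(x)\in\mathbb Z/2$ denotes the parity of a homogeneous element, and formulas are stated for homogeneous elements. A quadratic Lie superalgebra is a finite-dimensional Lie superalgebra $\mathfrak g$ with a non-degenerate bilinear form $B$ that is even ($B(x,y)=0$ if $p(x)\ne p(y)$), supersymmetric ($B(x,y)=(-1)^{p(x)p(y)}B(y,x)$) and invariant ($B([x,y],z)=B(x,[y,z])$). A quadratic pair $(\mathfrak g,\mathfrak l)$ consists of such a $\mathfrak g$ and a Lie subsuperalgebra $\mathfrak l\subset\mathfrak g$ on which $B$ is non-degenerate; then $\mathfrak l$ is quadratic with $B|_{\mathfrak l}$, and $\mathfrak p:=\mathfrak l^\perp$. The Clifford superalgebra $\mathrm{Cl}(\mathfrak g)$ is generated by $\mathfrak g$ with relations $xy+(-1)^{p(x)p(y)}yx=2B(x,y)$. With $\mathfrak U(\mathfrak g)$ and $\mathrm{Cl}(\mathfrak g)$ graded by the parity of $\mathfrak g$, $\mathcal W(\mathfrak g):=\mathfrak U(\mathfrak g)\otimes \mathrm{Cl}(\mathfrak g)$ is the $\mathbb Z/2$-graded tensor product, so $(u\otimes c)(u'\otimes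 c')=(-1)^{p(c)p(u')}uu'\otimes cc'$. For $x\in\mathfrak g$ the Lie derivative is $L_x(u\otimes c)=L_xu\otimes c+(-1)^{p(x)p(u)}u\otimes L_xc$, where on $\mathfrak U(\mathfrak g)$ and on $\mathrm{Cl}(\mathfrak g)$ $L_x$ is the superderivation of parity $p(x)$ extending $y\mapsto[x,y]$, and the contraction is $\iota_x(u\otimes c)=(-1)^{p(x)p(u)}u\otimes\iota_xc$, where $$\iota_x(x_1\cdots x_k)=\sum_{i=1}^k(-1)^{i-1}(-1)^{p(x)(p(x_1)+\cdots+p(x_{i-1}))}B(x,x_i)\,x_1\cdots\widehat{x_i}\cdots x_k .$$ Let $\mathcal W(\mathfrak g,\mathfrak l)$ be the space of all elements of $\mathfrak U(\mathfrak g)\otimes\mathrm{Cl}(\mathfrak p)\subset\mathcal W(\mathfrak g)$ that are annihilated by $L_x$ and $\iota_x$ for all $x\in\mathfrak l$. Let $(e_a)$ be a homogeneous basis of $\mathfrak g$ and $(e^a)$ its dual basis, $B(e_a,e^b)=\delta_{ab}$. Let $q(x_1\wedge\cdots\wedge x_k)\in\mathrm{Cl}(\mathfrak g)$ denote the graded antisymmetrization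 of $x_1\cdots x_k$ (with the factor $1/k!$). Put $\gamma'(x):=-\tfrac12\sum_a q([x,e^a]\wedge e_a)$, $\gamma^{\mathcal W(\mathfrak g)}(x):=x\otimes1-\tfrac12(1\otimes\gamma'(x))$, $f_{abc}:=B([e_a,e_b],e_c)$, $$\phi':=-\tfrac1{12}\sum_{a,b,c}(-1)^{p(e_a)p(e_b)+p(e_c)}f_{abc}\,q(e^a\wedge e^b\wedge e^c),\qquad D_{\mathfrak g}:=\sum_a e^a\otimes e_a+1\otimes\phi',$$ $\Omega_{\mathfrak g}:=\sum_a e^ae_a\in\mathfrak U(\mathfrak g)$ (also written for $\Omega_{\mathfrak g}\otimes1$), and let $\mathrm{str}_{\mathfrak g}(\Omega_{\mathfrak g})$ be the supertrace of $\Omega_{\mathfrak g}$ in the adjoint representation. The same notation is used for $\mathfrak l$ with a homogeneous basis of $\mathfrak l$ and the form $B|_{\mathfrak l}$. **Theorem.** Let $(\mathfrak g,\mathfrak l)$ be a quadratic pair, with any homogeneous bases of $\mathfrak g$ and $\mathfrak l$. There is a unique algebra homomorphism $j:\mathcal W(\mathfrak l)\to\mathcal W(\mathfrak g)$ with $j(1\otimes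 x)=1\otimes x$ and $j(\gamma^{\mathcal W(\mathfrak l)}(x))=\gamma^{\mathcal W(\mathfrak g)}(x)$ for all $x\in\mathfrak l$, and the relative cubic Dirac operator $D_{\mathfrak g,\mathfrak l}:=D_{\mathfrak g}-j(D_{\mathfrak l})$ satisfies: a) $D_{\mathfrak g,\mathfrak l}\in\mathcal W(\mathfrak g,\mathfrak l)$; b) $D_{\mathfrak g,\mathfrak l}^2=\Omega_{\mathfrak g}-j(\Omega_{\mathfrak l})+\tfrac1{24}\mathrm{str}_{\mathfrak g}(\Omega_{\mathfrak g})-\tfrac1{24}\mathrm{str}_{\mathfrak l}(\Omega_{\mathfrak l})$. -/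

import Mathlib

open scoped TensorProduct

namespace SuperWeil

noncomputable section

/-! ### Signs -/

/-- The sign `(-1)^(i * j)` of two parities. -/
def sgn (i j : ZMod 2) : ℂ := if i = 1 ∧ j = 1 then -1 else 1

theorem zmod2_cases : ∀ i : ZMod 2, i = 0 ∨ i = 1 := by decide

theorem sgn_add_right (i j k : ZMod 2) : sgn i (j + k) = sgn i j * sgn i k := by
  have h : (1 + 1 : ZMod 2) = 0 := by decide
  rcases zmod2_cases i with rfl | rfl <;> rcases zmod2_cases j with rfl | rfl <;>
    rcases zmod2_cases k with rfl | rfl <;> simp [sgn, h]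

theorem sgn_comm (i j : ZMod 2) : sgn i j = sgn j i := by simp [sgn, and_comm]

theorem sgn_add_left (i j k : ZMod 2) : sgn (i + j) k = sgn i k * sgn j k := by
  rw [sgn_comm, sgn_add_right, sgn_comm k i, sgn_comm k j]

theorem sgn_mul_self (i j : ZMod 2) : sgn i j * sgn i j = 1 := by
  unfold sgn; split_ifs <;> norm_num

/-! ### Lie superalgebras and quadratic Lie superalgebras over `ℂ` -/

/-- A complex Lie superalgebra: `par 0` and `par 1` are the even and the odd part. -/
class LieSuperalgebra (𝔤 : Type*) [AddCommGroup 𝔤] [Module ℂ 𝔤] where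
  par : ZMod 2 → Submodule ℂ 𝔤
  isCompl : IsCompl (par 0) (par 1)
  bracket : 𝔤 →ₗ[ℂ] 𝔤 →ₗ[ℂ] 𝔤
  bracket_mem : ∀ {i j : ZMod 2} {x y : 𝔤}, x ∈ par i → y ∈ par j → bracket x y ∈ par (i + j)
  bracket_skew : ∀ {i j : ZMod 2} {x y : 𝔤}, x ∈ par i → y ∈ par j →
    bracket x y = -(sgn i j • bracket y x)
  jacobi : ∀ {i j : ZMod 2} {x y : 𝔤} (z : 𝔤), x ∈ par i → y ∈ par j →
    bracket x (bracket y z) = bracket (bracket x y) z + sgn i j • bracket y (bracket x z)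

/-- A quadratic Lie superalgebra: `form` is non-degenerate, consistent (even), supersymmetric
and invariant. -/
class QuadraticLieSuperalgebra (𝔤 : Type*) [AddCommGroup 𝔤] [Module ℂ 𝔤]
    extends LieSuperalgebra 𝔤 where
  form : LinearMap.BilinForm ℂ 𝔤
  form_nondegenerate : form.Nondegenerate
  form_consistent : ∀ {i j : ZMod 2} {x y : 𝔤}, x ∈ par i → y ∈ par j → i ≠ j → form x y = 0
  form_supersymm : ∀ {i j : ZMod 2} {x y : 𝔤}, x ∈ par i → y ∈ par j →
    form x y = sgn i j * form y x
  form_invariant : ∀ x y z : 𝔤, form (bracket x y) z = form x (bracket y z)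

open LieSuperalgebra QuadraticLieSuperalgebra

/-- A quadratic Lie subsuperalgebra `𝔩 ⊂ 𝔤`: a graded subspace closed under the bracket on which
the form of `𝔤` is non-degenerate. So `(𝔤, 𝔩)` is a quadratic pair. -/
structure QuadraticSubalgebra (𝔤 : Type*) [AddCommGroup 𝔤] [Module ℂ 𝔤]
    [QuadraticLieSuperalgebra 𝔤] where
  toSubmodule : Submodule ℂ 𝔤
  graded : ∀ x ∈ toSubmodule, ∃ x₀ ∈ toSubmodule ⊓ par 0, ∃ x₁ ∈ toSubmodule ⊓ par 1, x = x₀ + x₁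
  bracket_mem' : ∀ x ∈ toSubmodule, ∀ y ∈ toSubmodule, bracket x y ∈ toSubmodule
  nondegenerate : (LinearMap.BilinForm.restrict form toSubmodule).Nondegenerate

/-- `𝔩` with the induced parity, bracket and form. -/
instance QuadraticSubalgebra.instQuadratic {𝔤 : Type*} [AddCommGroup 𝔤] [Module ℂ 𝔤]
    [QuadraticLieSuperalgebra 𝔤] (𝔩 : QuadraticSubalgebra 𝔤) :
    QuadraticLieSuperalgebra 𝔩.toSubmodule where
  par i := (par i).comap 𝔩.toSubmodule.subtype
  isCompl := by
    have hc := (isCompl : IsCompl (par (𝔤 := 𝔤) 0) (par 1))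
    constructor
    · rw [Submodule.disjoint_def]
      intro x h0 h1
      exact Subtype.ext (Submodule.disjoint_def.1 hc.disjoint x h0 h1)
    · rw [codisjoint_iff, eq_top_iff]
      rintro ⟨x, hx⟩ -
      obtain ⟨x₀, h₀, x₁, h₁, rfl⟩ := 𝔩.graded x hx
      exact Submodule.mem_sup.2 ⟨⟨x₀, h₀.1⟩, h₀.2, ⟨x₁, h₁.1⟩, h₁.2, rfl⟩
  bracket := LinearMap.mk₂ ℂ
    (fun x y => (⟨bracket (x : 𝔤) y, 𝔩.bracket_mem' _ x.2 _ y.2⟩ : 𝔩.toSubmodule))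
    (fun _ _ _ => Subtype.ext (by simp)) (fun _ _ _ => Subtype.ext (by simp))
    (fun _ _ _ => Subtype.ext (by simp)) (fun _ _ _ => Subtype.ext (by simp))
  bracket_mem hx hy := bracket_mem (𝔤 := 𝔤) hx hy
  bracket_skew hx hy := Subtype.ext (bracket_skew (𝔤 := 𝔤) hx hy)
  jacobi z hx hy := Subtype.ext (jacobi (𝔤 := 𝔤) (z : 𝔤) hx hy)
  form := LinearMap.BilinForm.restrict form 𝔩.toSubmodule
  form_nondegenerate := 𝔩.nondegenerate
  form_consistent hx hy h := form_consistent (𝔤 := 𝔤) hx hy h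
  form_supersymm hx hy := form_supersymm (𝔤 := 𝔤) hx hy
  form_invariant x y z := form_invariant (x : 𝔤) y z

section Lie

variable (𝔤 : Type*) [AddCommGroup 𝔤] [Module ℂ 𝔤] [LieSuperalgebra 𝔤]

/-- The parity involution: `1` on the even part and `-1` on the odd part. -/
def parity : 𝔤 →ₗ[ℂ] 𝔤 :=
  (par 0).projection (par 1) isCompl - (par 1).projection (par 0) isCompl.symm

/-- The `p`-th power of the parity involution: `y ↦ (-1)^(p * p(y)) y`. -/
def twist (p : ZMod 2) : 𝔤 →ₗ[ℂ] 𝔤 := if p = 1 then parity 𝔤 else LinearMap.id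

variable {𝔤}

theorem parity_apply {i : ZMod 2} {x : 𝔤} (hx : x ∈ par i) : parity 𝔤 x = sgn 1 i • x := by
  have hc := (isCompl : IsCompl (par (𝔤 := 𝔤) 0) (par 1))
  rcases zmod2_cases i with rfl | rfl
  · have h1 := Submodule.projection_apply_left hc ⟨x, hx⟩
    have h2 := (Submodule.projection_apply_eq_zero_iff hc.symm (x := x)).2 hx
    simp only at h1
    simp [parity, h1, h2, sgn]
  · have h1 := Submodule.projection_apply_left hc.symm ⟨x, hx⟩
    have h2 := (Submodule.projection_apply_eq_zero_iff hc (x := x)).2 hx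
    simp only at h1
    simp [parity, h1, h2, sgn]

theorem twist_apply (p : ZMod 2) {i : ZMod 2} {x : 𝔤} (hx : x ∈ par i) :
    twist 𝔤 p x = sgn p i • x := by
  rcases zmod2_cases p with rfl | rfl
  · simp [twist, sgn]
  · simpa [twist] using parity_apply hx

theorem linearMap_ext {M : Type*} [AddCommGroup M] [Module ℂ M] {f g : 𝔤 →ₗ[ℂ] M}
    (h : ∀ (i : ZMod 2) (x : 𝔤), x ∈ par i → f x = g x) : f = g := by
  have hc := (isCompl : IsCompl (par (𝔤 := 𝔤) 0) (par 1))
  ext x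
  obtain ⟨a, ha, b, hb, rfl⟩ := Submodule.mem_sup.1
    (hc.sup_eq_top ▸ Submodule.mem_top : x ∈ par (𝔤 := 𝔤) 0 ⊔ par 1)
  rw [map_add, map_add, h 0 a ha, h 1 b hb]

theorem parity_parity : parity 𝔤 ∘ₗ parity 𝔤 = LinearMap.id :=
  linearMap_ext fun i x hx => by
    simp [parity_apply hx, smul_smul, sgn_mul_self]

end Lie

/-! ### The grading by the eigenspaces of an involution -/

section Grading

variable {A : Type*} [Ring A] [Algebra ℂ A]

/-- The `i`-th graded piece `{a | P a = (-1)^i a}` for an involutive automorphism `P`. -/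
def eig (P : A →ₐ[ℂ] A) (i : ZMod 2) : Submodule ℂ A where
  carrier := {a | P a = sgn 1 i • a}
  add_mem' {a b} ha hb := by
    simp only [Set.mem_ofPred_eq] at *
    rw [map_add, ha, hb, smul_add]
  zero_mem' := by simp
  smul_mem' c a ha := by
    simp only [Set.mem_ofPred_eq] at *
    rw [map_smul, ha, smul_comm]

theorem mem_eig {P : A →ₐ[ℂ] A} {i : ZMod 2} {a : A} : a ∈ eig P i ↔ P a = sgn 1 i • a := Iff.rfl

instance eig_gradedMonoid (P : A →ₐ[ℂ] A) : SetLike.GradedMonoid (eig P) where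
  one_mem := by simp [mem_eig, sgn]
  mul_mem i j a b ha hb := by
    rw [mem_eig] at *
    rw [map_mul, ha, hb, sgn_add_right, smul_mul_smul_comm]

/-- The half-sum `(a + (-1)^i P a) / 2`, as an element of the `i`-th graded piece. -/
def eigProj (P : A →ₐ[ℂ] A) (hP : ∀ a, P (P a) = a) (i : ZMod 2) : A →ₗ[ℂ] eig P i :=
  LinearMap.codRestrict (eig P i)
    ((1 / 2 : ℂ) • (LinearMap.id + sgn 1 i • P.toLinearMap)) (fun a => by
      rw [mem_eig]
      simp only [LinearMap.smul_apply, LinearMap.add_apply, LinearMap.id_apply,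
        AlgHom.toLinearMap_apply, map_smul, map_add, hP]
      rw [smul_comm, smul_add (sgn 1 i), smul_smul (sgn 1 i) (sgn 1 i), sgn_mul_self, one_smul,
        add_comm])

theorem eigProj_coe (P : A →ₐ[ℂ] A) (hP : ∀ a, P (P a) = a) (i : ZMod 2) (a : A) :
    (eigProj P hP i a : A) = (1 / 2 : ℂ) • (a + sgn 1 i • P a) := rfl

/-- The eigenspaces of an involutive automorphism grade the algebra. -/
abbrev eigGraded (P : A →ₐ[ℂ] A) (hP : ∀ a, P (P a) = a) : GradedAlgebra (eig P) where
  decompose' a := DirectSum.of (fun i => eig P i) 0 (eigProj P hP 0 a) +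
    DirectSum.of (fun i => eig P i) 1 (eigProj P hP 1 a)
  left_inv a := by
    simp only [map_add, DirectSum.coeAddMonoidHom_of, eigProj_coe]
    have h0 : sgn 1 0 = 1 := by simp [sgn]
    have h1 : sgn 1 1 = -1 := by simp [sgn]
    rw [h0, h1]
    module
  right_inv x := by
    induction x using DirectSum.induction_on with
    | zero => simp
    | add x y hx hy =>
      dsimp only at hx hy ⊢
      rw [map_add, map_add, map_add, map_add, map_add, add_add_add_comm, hx, hy]
    | of i x =>
      have hx : P (x : A) = sgn 1 i • (x : A) := x.2
      rw [DirectSum.coeAddMonoidHom_of]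
      have key : ∀ j, j ≠ i → eigProj P hP j (x : A) = 0 := by
        intro j hj
        apply Subtype.ext
        rw [eigProj_coe, hx]
        rcases zmod2_cases i with rfl | rfl <;> rcases zmod2_cases j with rfl | rfl <;>
          simp_all [sgn]
      have key' : eigProj P hP i (x : A) = x := by
        apply Subtype.ext
        rw [eigProj_coe, hx, smul_smul, sgn_mul_self]
        module
      dsimp only
      rcases zmod2_cases i with rfl | rfl
      · rw [key', key 1 (by decide), map_zero, add_zero]
      · rw [key', key 0 (by decide), map_zero, zero_add]

end Grading

/-! ### The universal enveloping algebra -/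

section Enveloping

variable (𝔤 : Type*) [AddCommGroup 𝔤] [Module ℂ 𝔤] [LieSuperalgebra 𝔤]

/-- The relations `xy = (-1)^(p(x)p(y)) yx + [x,y]` for homogeneous `x`, `y`. -/
inductive URel : TensorAlgebra ℂ 𝔤 → TensorAlgebra ℂ 𝔤 → Prop
  | mk {i j : ZMod 2} {x y : 𝔤} (hx : x ∈ par i) (hy : y ∈ par j) :
      URel (TensorAlgebra.ι ℂ x * TensorAlgebra.ι ℂ y)
        (sgn i j • (TensorAlgebra.ι ℂ y * TensorAlgebra.ι ℂ x) + TensorAlgebra.ι ℂ (bracket x y))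

/-- The universal enveloping algebra `𝔘(𝔤)`. -/
def Env := RingQuot (URel 𝔤)

instance : Ring (Env 𝔤) := inferInstanceAs (Ring (RingQuot (URel 𝔤)))

instance : Algebra ℂ (Env 𝔤) := inferInstanceAs (Algebra ℂ (RingQuot (URel 𝔤)))

variable {𝔤}

/-- The canonical map `𝔤 → 𝔘(𝔤)`. -/
def Env.ι : 𝔤 →ₗ[ℂ] Env 𝔤 :=
  (RingQuot.mkAlgHom ℂ (URel 𝔤)).toLinearMap ∘ₗ TensorAlgebra.ι ℂ

theorem Env.ι_mul_ι {i j : ZMod 2} {x y : 𝔤} (hx : x ∈ par i) (hy : y ∈ par j) :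
    Env.ι x * Env.ι y = sgn i j • (Env.ι y * Env.ι x) + Env.ι (bracket x y) := by
  have h := RingQuot.mkAlgHom_rel ℂ (URel.mk hx hy)
  simp only [map_mul, map_add, map_smul] at h
  exact h

/-- The universal property of `𝔘(𝔤)`. -/
def Env.lift {A : Type*} [Ring A] [Algebra ℂ A] (f : 𝔤 →ₗ[ℂ] A)
    (hf : ∀ (i j : ZMod 2) (x y : 𝔤), x ∈ par i → y ∈ par j →
      f x * f y = sgn i j • (f y * f x) + f (bracket x y)) : Env 𝔤 →ₐ[ℂ] A :=
  RingQuot.liftAlgHom ℂ ⟨TensorAlgebra.lift ℂ f, by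
    rintro _ _ ⟨hx, hy⟩
    simpa using hf _ _ _ _ hx hy⟩

theorem Env.lift_ι {A : Type*} [Ring A] [Algebra ℂ A] (f : 𝔤 →ₗ[ℂ] A)
    (hf : ∀ (i j : ZMod 2) (x y : 𝔤), x ∈ par i → y ∈ par j →
      f x * f y = sgn i j • (f y * f x) + f (bracket x y)) (x : 𝔤) :
    Env.lift f hf (Env.ι x) = f x :=
  (RingQuot.liftAlgHom_mkAlgHom_apply ℂ (TensorAlgebra.lift ℂ f) _ _).trans
    (TensorAlgebra.lift_ι_apply f x)

theorem Env.hom_ext {A : Type*} [Ring A] [Algebra ℂ A] {f g : Env 𝔤 →ₐ[ℂ] A}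
    (h : ∀ x, f (Env.ι x) = g (Env.ι x)) : f = g :=
  RingQuot.ringQuot_ext' _ _ _ (TensorAlgebra.hom_ext (LinearMap.ext h))

/-- The parity automorphism of `𝔘(𝔤)`, extending the parity involution of `𝔤`. -/
def Env.parity : Env 𝔤 →ₐ[ℂ] Env 𝔤 :=
  Env.lift (Env.ι ∘ₗ SuperWeil.parity 𝔤) (fun i j x y hx hy => by
    simp only [LinearMap.comp_apply, parity_apply hx, parity_apply hy,
      parity_apply (bracket_mem hx hy), map_smul, smul_mul_smul_comm, Env.ι_mul_ι hx hy,
      sgn_add_right, smul_add, smul_smul]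
    congr 2
    ring)

theorem Env.parity_parity (a : Env 𝔤) : Env.parity (Env.parity a) = a := by
  have : (Env.parity (𝔤 := 𝔤)).comp Env.parity = AlgHom.id ℂ _ := Env.hom_ext fun x => by
    simp only [Env.parity, AlgHom.comp_apply, Env.lift_ι, LinearMap.comp_apply, AlgHom.id_apply]
    exact congrArg Env.ι (LinearMap.congr_fun SuperWeil.parity_parity x)
  exact AlgHom.congr_fun this a

variable (𝔤) in
/-- The `ℤ/2`-grading of `𝔘(𝔤)` induced by the parity of `𝔤`. -/
abbrev Env.grading : ZMod 2 → Submodule ℂ (Env 𝔤) := eig Env.parity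

instance : GradedAlgebra (Env.grading 𝔤) := eigGraded Env.parity Env.parity_parity

/-- `a ↦ (-1)^(p * p(a)) a` on `𝔘(𝔤)`. -/
def Env.twist (p : ZMod 2) : Env 𝔤 →ₐ[ℂ] Env 𝔤 :=
  if p = 1 then Env.parity else AlgHom.id ℂ _

/-- The adjoint representation `𝔘(𝔤) → End(𝔤)`. -/
def Env.ad : Env 𝔤 →ₐ[ℂ] Module.End ℂ 𝔤 :=
  Env.lift bracket (fun i j x y hx hy => LinearMap.ext fun z => by
    simp only [Module.End.mul_apply, LinearMap.add_apply, LinearMap.smul_apply]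
    rw [jacobi z hx hy, add_comm])

/-- The supertrace of an endomorphism: the trace on the even part minus that on the odd part. -/
def str (T : Module.End ℂ 𝔤) : ℂ := LinearMap.trace ℂ 𝔤 (parity 𝔤 ∘ₗ T)

end Enveloping

/-! ### Twisted derivations from triangular matrices

A linear map `d` with `d (a b) = d a * b + s a * d b`, for an algebra endomorphism `s`, is the same
as an algebra homomorphism `a ↦ !![s a, d a; 0, a]`. -/

/-- The map `y ↦ !![s y, d y; 0, m y]`. -/
def triangular {V A : Type*} [AddCommGroup V] [Module ℂ V] [Ring A] [Algebra ℂ A]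
    (s d m : V →ₗ[ℂ] A) : V →ₗ[ℂ] Matrix (Fin 2) (Fin 2) A where
  toFun y := !![s y, d y; 0, m y]
  map_add' x y := by ext i j; fin_cases i <;> fin_cases j <;> simp
  map_smul' c x := by ext i j; fin_cases i <;> fin_cases j <;> simp

/-- The upper right entry of a matrix-valued algebra homomorphism. -/
def upperRight {A : Type*} [Ring A] [Algebra ℂ A] (Φ : A →ₐ[ℂ] Matrix (Fin 2) (Fin 2) A) :
    A →ₗ[ℂ] A where
  toFun a := Φ a 0 1
  map_add' x y := by simp
  map_smul' c x := by simp

section EnvelopingLie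

variable {𝔤 : Type*} [AddCommGroup 𝔤] [Module ℂ 𝔤] [LieSuperalgebra 𝔤]

/-- The Lie derivative `L_x` on `𝔘(𝔤)` for `x` of parity `p`: the superderivation of parity `p`
with `y ↦ [x,y]` on `𝔤`. -/
def Env.lieDer {p : ZMod 2} (x : par (𝔤 := 𝔤) p) : Env 𝔤 →ₗ[ℂ] Env 𝔤 :=
  upperRight (Env.lift
    (triangular (Env.ι ∘ₗ SuperWeil.twist 𝔤 p) (Env.ι ∘ₗ bracket (x : 𝔤)) Env.ι)
    (fun i j y z hy hz => by
      have h1 := Env.ι_mul_ι hy hz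
      have h2 := Env.ι_mul_ι hy (bracket_mem x.2 hz)
      have h3 := Env.ι_mul_ι (bracket_mem x.2 hy) hz
      have h4 := jacobi z x.2 hy
      simp only [triangular, LinearMap.coe_mk, AddHom.coe_mk, LinearMap.comp_apply,
        twist_apply p hy, twist_apply p hz, twist_apply p (bracket_mem hy hz)]
      ext a b
      fin_cases a <;> fin_cases b
      · simp only [map_smul, Matrix.mul_apply, Fin.sum_univ_two, Matrix.add_apply,
          Matrix.smul_apply]
        simp [h1, sgn_add_right, smul_smul]
        module
      · simp only [map_smul, Matrix.mul_apply, Fin.sum_univ_two, Matrix.add_apply,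
          Matrix.smul_apply]
        simp [h2, h3, h4, sgn_add_right, sgn_add_left, smul_smul]
        rcases zmod2_cases i with rfl | rfl <;> rcases zmod2_cases j with rfl | rfl <;>
          rcases zmod2_cases p with rfl | rfl <;> simp [sgn] <;> abel
      · simp
      · simpa using h1))

end EnvelopingLie

/-! ### The Clifford superalgebra -/

section Clifford

variable (𝔤 : Type*) [AddCommGroup 𝔤] [Module ℂ 𝔤] [QuadraticLieSuperalgebra 𝔤]

/-- The relations `xy + (-1)^(p(x)p(y)) yx = 2 B(x,y)` for homogeneous `x`, `y`. -/
inductive ClRel : TensorAlgebra ℂ 𝔤 → TensorAlgebra ℂ 𝔤 → Prop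
  | mk {i j : ZMod 2} {x y : 𝔤} (hx : x ∈ par i) (hy : y ∈ par j) :
      ClRel (TensorAlgebra.ι ℂ x * TensorAlgebra.ι ℂ y +
          sgn i j • (TensorAlgebra.ι ℂ y * TensorAlgebra.ι ℂ x))
        (algebraMap ℂ _ (2 * form x y))

/-- The Clifford superalgebra `Cl(𝔤)`. -/
def Cl := RingQuot (ClRel 𝔤)

instance : Ring (Cl 𝔤) := inferInstanceAs (Ring (RingQuot (ClRel 𝔤)))

instance : Algebra ℂ (Cl 𝔤) := inferInstanceAs (Algebra ℂ (RingQuot (ClRel 𝔤)))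

variable {𝔤}

/-- The canonical map `𝔤 → Cl(𝔤)`. -/
def Cl.ι : 𝔤 →ₗ[ℂ] Cl 𝔤 :=
  (RingQuot.mkAlgHom ℂ (ClRel 𝔤)).toLinearMap ∘ₗ TensorAlgebra.ι ℂ

theorem Cl.ι_mul_ι {i j : ZMod 2} {x y : 𝔤} (hx : x ∈ par i) (hy : y ∈ par j) :
    Cl.ι x * Cl.ι y + sgn i j • (Cl.ι y * Cl.ι x) = algebraMap ℂ _ (2 * form x y) := by
  have h := RingQuot.mkAlgHom_rel ℂ (ClRel.mk hx hy)
  rw [AlgHom.commutes, map_add, map_smul, map_mul, map_mul] at h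
  exact h

/-- The universal property of `Cl(𝔤)`. -/
def Cl.lift {A : Type*} [Ring A] [Algebra ℂ A] (f : 𝔤 →ₗ[ℂ] A)
    (hf : ∀ (i j : ZMod 2) (x y : 𝔤), x ∈ par i → y ∈ par j →
      f x * f y + sgn i j • (f y * f x) = algebraMap ℂ A (2 * form x y)) : Cl 𝔤 →ₐ[ℂ] A :=
  RingQuot.liftAlgHom ℂ ⟨TensorAlgebra.lift ℂ f, by
    rintro _ _ ⟨hx, hy⟩
    simpa using hf _ _ _ _ hx hy⟩

theorem Cl.lift_ι {A : Type*} [Ring A] [Algebra ℂ A] (f : 𝔤 →ₗ[ℂ] A)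
    (hf : ∀ (i j : ZMod 2) (x y : 𝔤), x ∈ par i → y ∈ par j →
      f x * f y + sgn i j • (f y * f x) = algebraMap ℂ A (2 * form x y)) (x : 𝔤) :
    Cl.lift f hf (Cl.ι x) = f x :=
  (RingQuot.liftAlgHom_mkAlgHom_apply ℂ (TensorAlgebra.lift ℂ f) _ _).trans
    (TensorAlgebra.lift_ι_apply f x)

theorem Cl.hom_ext {A : Type*} [Ring A] [Algebra ℂ A] {f g : Cl 𝔤 →ₐ[ℂ] A}
    (h : ∀ x, f (Cl.ι x) = g (Cl.ι x)) : f = g :=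
  RingQuot.ringQuot_ext' _ _ _ (TensorAlgebra.hom_ext (LinearMap.ext h))

/-- On `𝔤` the form only pairs vectors of equal parity, so it absorbs these signs. -/
theorem sgn_mul_form (p : ZMod 2) {i j : ZMod 2} {x y : 𝔤} (hx : x ∈ par i) (hy : y ∈ par j) :
    sgn p i * sgn p j * form x y = form x y := by
  by_cases h : i = j
  · subst h; rw [sgn_mul_self, one_mul]
  · rw [form_consistent hx hy h, mul_zero]

theorem Cl.twisted_rel (p : ZMod 2) {i j : ZMod 2} {x y : 𝔤} (hx : x ∈ par i) (hy : y ∈ par j) :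
    (sgn p i • Cl.ι x) * (sgn p j • Cl.ι y) + sgn i j • ((sgn p j • Cl.ι y) * (sgn p i • Cl.ι x)) =
      algebraMap ℂ _ (2 * form x y) := by
  rw [smul_mul_smul_comm, smul_mul_smul_comm, ← sgn_mul_form p hx hy, smul_comm (sgn i j),
    mul_comm (sgn p j), ← smul_add, Cl.ι_mul_ι hx hy, Algebra.smul_def, ← map_mul]
  congr 1
  ring

/-- The parity automorphism of `Cl(𝔤)`, extending the parity involution of `𝔤`. -/
def Cl.parity : Cl 𝔤 →ₐ[ℂ] Cl 𝔤 :=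
  Cl.lift (Cl.ι ∘ₗ SuperWeil.parity 𝔤) (fun i j x y hx hy => by
    simpa only [LinearMap.comp_apply, parity_apply hx, parity_apply hy, map_smul] using
      Cl.twisted_rel 1 hx hy)

theorem Cl.parity_parity (a : Cl 𝔤) : Cl.parity (Cl.parity a) = a := by
  have : (Cl.parity (𝔤 := 𝔤)).comp Cl.parity = AlgHom.id ℂ _ := Cl.hom_ext fun x => by
    simp only [Cl.parity, AlgHom.comp_apply, Cl.lift_ι, LinearMap.comp_apply, AlgHom.id_apply]
    exact congrArg Cl.ι (LinearMap.congr_fun SuperWeil.parity_parity x)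
  exact AlgHom.congr_fun this a

variable (𝔤) in
/-- The `ℤ/2`-grading of `Cl(𝔤)` induced by the parity of `𝔤` (not by the word length). -/
abbrev Cl.grading : ZMod 2 → Submodule ℂ (Cl 𝔤) := eig Cl.parity

instance : GradedAlgebra (Cl.grading 𝔤) := eigGraded Cl.parity Cl.parity_parity

/-- The Lie derivative `L_x` on `Cl(𝔤)` for `x` of parity `p`: the superderivation of parity `p`
with `y ↦ [x,y]` on `𝔤`. -/
def Cl.lieDer {p : ZMod 2} (x : par (𝔤 := 𝔤) p) : Cl 𝔤 →ₗ[ℂ] Cl 𝔤 :=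
  upperRight (Cl.lift
    (triangular (Cl.ι ∘ₗ SuperWeil.twist 𝔤 p) (Cl.ι ∘ₗ bracket (x : 𝔤)) Cl.ι)
    (fun i j y z hy hz => by
      have h1 := Cl.ι_mul_ι hy hz
      have h2 := Cl.ι_mul_ι hy (bracket_mem x.2 hz)
      have h3 := Cl.ι_mul_ι (bracket_mem x.2 hy) hz
      have h4 : form (bracket (x : 𝔤) y) z = -(sgn p i * form y (bracket (x : 𝔤) z)) := by
        rw [bracket_skew x.2 hy, map_neg, map_smul, LinearMap.neg_apply, LinearMap.smul_apply,
          form_invariant, smul_eq_mul]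
      have h5 : sgn p i • (Cl.ι y * Cl.ι (bracket (x : 𝔤) z)) + Cl.ι (bracket (x : 𝔤) y) * Cl.ι z +
          sgn i j • (sgn p j • (Cl.ι z * Cl.ι (bracket (x : 𝔤) y)) +
            Cl.ι (bracket (x : 𝔤) z) * Cl.ι y) = 0 := by
        calc _ = sgn p i • (Cl.ι y * Cl.ι (bracket (x : 𝔤) z) +
                sgn i (p + j) • (Cl.ι (bracket (x : 𝔤) z) * Cl.ι y)) +
              (Cl.ι (bracket (x : 𝔤) y) * Cl.ι z +
                sgn (p + i) j • (Cl.ι z * Cl.ι (bracket (x : 𝔤) y))) := by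
              rw [sgn_add_right, sgn_add_left, sgn_comm i p, smul_add (sgn p i), smul_smul (sgn p i),
                ← mul_assoc, sgn_mul_self, one_mul, smul_add, smul_smul, mul_comm (sgn i j)]
              abel
          _ = 0 := by
              rw [h2, h3, h4, Algebra.smul_def, ← map_mul, ← map_add,
                ← map_zero (algebraMap ℂ (Cl 𝔤))]
              congr 1
              ring
      have h6 := Cl.twisted_rel p hy hz
      simp only [triangular, LinearMap.coe_mk, AddHom.coe_mk, LinearMap.comp_apply,
        twist_apply p hy, twist_apply p hz]
      ext a b
      fin_cases a <;> fin_cases b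
      · simp only [map_smul, Matrix.mul_apply, Fin.sum_univ_two, Matrix.add_apply,
          Matrix.smul_apply]
        simpa [Matrix.algebraMap_matrix_apply] using h6
      · simp only [map_smul, Matrix.mul_apply, Fin.sum_univ_two, Matrix.add_apply,
          Matrix.smul_apply]
        simpa [Matrix.algebraMap_matrix_apply] using h5
      · simp [Matrix.algebraMap_matrix_apply]
      · simpa [Matrix.mul_apply, Matrix.algebraMap_matrix_apply] using h1))

/-- The contraction `ι_x` on `Cl(𝔤)` for `x` of parity `p`: on words it is
`x₁⋯xₗ ↦ ∑ₖ (-1)^(k-1) (-1)^(p (p(x₁)+⋯+p(xₖ₋₁))) B(x,xₖ) x₁⋯x̂ₖ⋯xₗ`. -/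
def Cl.contraction {p : ZMod 2} (x : par (𝔤 := 𝔤) p) : Cl 𝔤 →ₗ[ℂ] Cl 𝔤 :=
  upperRight (Cl.lift
    (triangular (-(Cl.ι ∘ₗ SuperWeil.twist 𝔤 p))
      (Algebra.linearMap ℂ (Cl 𝔤) ∘ₗ form (x : 𝔤)) Cl.ι)
    (fun i j y z hy hz => by
      have h1 := Cl.ι_mul_ι hy hz
      have h2 := Cl.twisted_rel p hy hz
      have h3 : -(form (x : 𝔤) z • (sgn p i • Cl.ι y)) + form (x : 𝔤) y • Cl.ι z +
          sgn i j • (-(form (x : 𝔤) y • (sgn p j • Cl.ι z)) + form (x : 𝔤) z • Cl.ι y) = 0 := by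
        have hz' : sgn i j * form (x : 𝔤) z = sgn p i * form (x : 𝔤) z := by
          by_cases h : p = j
          · subst h; rw [sgn_comm]
          · rw [form_consistent x.2 hz h, mul_zero, mul_zero]
        have hy' : sgn i j * (sgn p j * form (x : 𝔤) y) = form (x : 𝔤) y := by
          by_cases h : p = i
          · subst h; rw [← mul_assoc, sgn_mul_self, one_mul]
          · rw [form_consistent x.2 hy h, mul_zero, mul_zero]
        rw [smul_comm (form (x : 𝔤) z), smul_comm (form (x : 𝔤) y) (sgn p j), smul_add, smul_neg,
          smul_smul, smul_smul, smul_smul, smul_smul, hz', mul_assoc, hy']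
        abel
      simp only [triangular, LinearMap.coe_mk, AddHom.coe_mk, LinearMap.comp_apply,
        LinearMap.neg_apply, twist_apply p hy, twist_apply p hz, Algebra.linearMap_apply]
      ext a b
      fin_cases a <;> fin_cases b
      · simp only [map_smul, Matrix.mul_apply, Fin.sum_univ_two, Matrix.add_apply,
          Matrix.smul_apply]
        simpa [Matrix.algebraMap_matrix_apply] using h2
      · simp only [map_smul, Matrix.mul_apply, Fin.sum_univ_two, Matrix.add_apply,
          Matrix.smul_apply]
        simpa [Matrix.algebraMap_matrix_apply, Algebra.algebraMap_eq_smul_one] using h3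
      · simp [Matrix.algebraMap_matrix_apply]
      · simpa [Matrix.mul_apply, Matrix.algebraMap_matrix_apply] using h1))

end Clifford

/-! ### The colour quantum Weil algebra -/

section Weil

variable (𝔤 : Type*) [AddCommGroup 𝔤] [Module ℂ 𝔤] [QuadraticLieSuperalgebra 𝔤]

/-- The colour quantum Weil algebra `𝒲(𝔤) = 𝔘(𝔤) ⊗ Cl(𝔤)`, the `ℤ/2`-graded tensor product:
`(u ⊗ c)(u' ⊗ c') = (-1)^(p(c)p(u')) uu' ⊗ cc'`. -/
abbrev Weil := GradedTensorProduct ℂ (Env.grading 𝔤) (Cl.grading 𝔤)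

variable {𝔤}

/-- The element `u ⊗ c` of `𝒲(𝔤)`. -/
abbrev Weil.tmul (u : Env 𝔤) (c : Cl 𝔤) : Weil 𝔤 :=
  GradedTensorProduct.tmul ℂ (𝒜 := Env.grading 𝔤) (ℬ := Cl.grading 𝔤) u c

/-- The linear map `u ⊗ c ↦ S u ⊗ T c` on `𝒲(𝔤)`, without further signs. -/
def Weil.map (S : Env 𝔤 →ₗ[ℂ] Env 𝔤) (T : Cl 𝔤 →ₗ[ℂ] Cl 𝔤) : Weil 𝔤 →ₗ[ℂ] Weil 𝔤 :=
  (GradedTensorProduct.of ℂ (Env.grading 𝔤) (Cl.grading 𝔤)).toLinearMap ∘ₗ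
    TensorProduct.map S T ∘ₗ
      (GradedTensorProduct.of ℂ (Env.grading 𝔤) (Cl.grading 𝔤)).symm.toLinearMap

/-- The Lie derivative `L_x (u ⊗ c) = L_x u ⊗ c + (-1)^(p(x)p(u)) u ⊗ L_x c` on `𝒲(𝔤)`. -/
def Weil.lieDer {p : ZMod 2} (x : par (𝔤 := 𝔤) p) : Weil 𝔤 →ₗ[ℂ] Weil 𝔤 :=
  Weil.map (Env.lieDer x) LinearMap.id + Weil.map (Env.twist p).toLinearMap (Cl.lieDer x)

/-- The contraction `ι_x (u ⊗ c) = (-1)^(p(x)p(u)) u ⊗ ι_x c` on `𝒲(𝔤)`. -/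
def Weil.contraction {p : ZMod 2} (x : par (𝔤 := 𝔤) p) : Weil 𝔤 →ₗ[ℂ] Weil 𝔤 :=
  Weil.map (Env.twist p).toLinearMap (Cl.contraction x)

end Weil

/-! ### Quantization, and the cubic Dirac operator -/

/-- The sign `p(σ; x₁,…,xₖ)` for elements `xᵢ` of parity `d i`. -/
def koszulSign {k : ℕ} (σ : Equiv.Perm (Fin k)) (d : Fin k → ZMod 2) : ℂ :=
  ((Equiv.Perm.sign σ : ℤ) : ℂ) *
    ∏ i : Fin k, ∏ j : Fin k, if i < j ∧ σ.symm j < σ.symm i then sgn (d i) (d j) else 1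

section Dirac

variable {𝔤 : Type*} [AddCommGroup 𝔤] [Module ℂ 𝔤] [QuadraticLieSuperalgebra 𝔤]

/-- The quantization `q(x₁ ∧ ⋯ ∧ xₖ) ∈ Cl(𝔤)` for elements `xᵢ` of parity `d i`: the graded
antisymmetrization of the Clifford product `x₁⋯xₖ`. -/
def quantization {k : ℕ} (d : Fin k → ZMod 2) (x : Fin k → 𝔤) : Cl 𝔤 :=
  (1 / (k.factorial : ℂ)) •
    ∑ σ : Equiv.Perm (Fin k), koszulSign σ d • (List.ofFn fun i => Cl.ι (x (σ i))).prod

variable (𝔤) in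
/-- A homogeneous basis `e a` of `𝔤`, of parities `deg a`, with its `B`-dual basis `dual a`,
that is, `B(e a, dual b) = δ_{ab}`. -/
structure HomogeneousBasis (I : Type*) where
  e : Module.Basis I ℂ 𝔤
  deg : I → ZMod 2
  mem : ∀ a, e a ∈ par (deg a)
  dual : I → 𝔤
  form_self : ∀ a, form (e a) (dual a) = 1
  form_ne : ∀ a b, a ≠ b → form (e a) (dual b) = 0

namespace HomogeneousBasis

variable {I : Type*} [Fintype I] (b : HomogeneousBasis 𝔤 I)

/-- `γ'(x) = q(λ(ad_x))` for `x` of parity `p`, where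
`λ(ad_x) = -1/2 ∑ₐ [x, eᵃ] ∧ eₐ ∈ ⋀²(𝔤)`. -/
def gammaPrime (p : ZMod 2) (x : 𝔤) : Cl 𝔤 :=
  (-(1 / 2) : ℂ) • ∑ a, quantization ![p + b.deg a, b.deg a] ![bracket x (b.dual a), b.e a]

/-- The generator `γ^𝒲(x) = x ⊗ 1 - 1/2 (1 ⊗ γ'(x))` of `𝒲(𝔤)` for `x` of parity `p`. -/
def gammaWeil (p : ZMod 2) (x : 𝔤) : Weil 𝔤 :=
  Weil.tmul (Env.ι x) 1 - (1 / 2 : ℂ) • Weil.tmul 1 (b.gammaPrime p x)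

/-- `φ' = q(φ)` for the structure constants tensor
`φ = -1/12 ∑ (-1)^(p(eₐ)p(e_b)+p(e_c)) f_{abc} eᵃ ∧ e^b ∧ e^c`, with `f_{abc} = B([eₐ,e_b],e_c)`. -/
def phiPrime : Cl 𝔤 :=
  (-(1 / 12) : ℂ) • ∑ i, ∑ j, ∑ k,
    (sgn (b.deg i) (b.deg j) * sgn 1 (b.deg k) * form (bracket (b.e i) (b.e j)) (b.e k)) •
      quantization ![b.deg i, b.deg j, b.deg k] ![b.dual i, b.dual j, b.dual k]

/-- The cubic Dirac operator `D_𝔤 = ∑ₐ eᵃ ⊗ eₐ + 1 ⊗ φ'`. -/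
def dirac : Weil 𝔤 :=
  ∑ a, Weil.tmul (Env.ι (b.dual a)) (Cl.ι (b.e a)) + Weil.tmul 1 b.phiPrime

/-- The quadratic Casimir element `Ω_𝔤 = ∑ₐ eᵃ eₐ ∈ 𝔘(𝔤)`. -/
def casimir : Env 𝔤 := ∑ a, Env.ι (b.dual a) * Env.ι (b.e a)

/-- `str_𝔤(Ω_𝔤)`: the supertrace of `Ω_𝔤` in the adjoint representation. -/
def strCasimir : ℂ := str (Env.ad b.casimir)

end HomogeneousBasis

end Dirac

/-! ### Quadratic pairs -/

section Relative

variable {𝔤 : Type*} [AddCommGroup 𝔤] [Module ℂ 𝔤] [QuadraticLieSuperalgebra 𝔤]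

namespace QuadraticSubalgebra

variable (𝔩 : QuadraticSubalgebra 𝔤)

/-- `𝔭 = 𝔩^⊥`. -/
def orth : Submodule ℂ 𝔤 where
  carrier := {y | ∀ x ∈ 𝔩.toSubmodule, form x y = 0}
  add_mem' ha hb x hx := by rw [map_add, ha x hx, hb x hx, add_zero]
  zero_mem' x _ := map_zero _
  smul_mem' c y hy x hx := by rw [map_smul, hy x hx, smul_zero]

/-- The subspace `𝔘(𝔤) ⊗ Cl(𝔭)` of `𝒲(𝔤)`, where `Cl(𝔭)` is the subalgebra of `Cl(𝔤)` generated
by `𝔭`. -/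
def envTensorClOrth : Submodule ℂ (Weil 𝔤) :=
  Submodule.span ℂ {w | ∃ u : Env 𝔤, ∃ c ∈ Algebra.adjoin ℂ (Cl.ι '' (𝔩.orth : Set 𝔤)),
    w = Weil.tmul u c}

/-- `𝒲(𝔤,𝔩) = (𝔘(𝔤) ⊗ Cl(𝔭))^𝔩`, the space of `𝔩`-basic elements: those elements of
`𝔘(𝔤) ⊗ Cl(𝔭)` that are annihilated by `L_x` and `ι_x` for all `x ∈ 𝔩`. By linearity in `x`,
homogeneous `x` suffice. -/
def relWeil : Submodule ℂ (Weil 𝔤) :=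
  𝔩.envTensorClOrth ⊓ ⨅ (p : ZMod 2) (x : par (𝔤 := 𝔤) p) (_ : (x : 𝔤) ∈ 𝔩.toSubmodule),
    LinearMap.ker (Weil.lieDer x) ⊓ LinearMap.ker (Weil.contraction x)

/-- The defining property of the canonical map `j : 𝒲(𝔩) → 𝒲(𝔤)`: it is the algebra homomorphism
with `j(1 ⊗ x) = 1 ⊗ x` and `j(γ^{𝒲(𝔩)}(x)) = γ^{𝒲(𝔤)}(x)` for `x ∈ 𝔩`. -/
def IsCanonicalMap {I J : Type*} [Fintype I] [Fintype J] (e : HomogeneousBasis 𝔤 I)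
    (f : HomogeneousBasis 𝔩.toSubmodule J) (j : Weil 𝔩.toSubmodule →ₐ[ℂ] Weil 𝔤) : Prop :=
  (∀ x : 𝔩.toSubmodule, j (Weil.tmul 1 (Cl.ι x)) = Weil.tmul 1 (Cl.ι (x : 𝔤))) ∧
    ∀ (p : ZMod 2) (x : 𝔩.toSubmodule), x ∈ par p →
      j (f.gammaWeil p x) = e.gammaWeil p (x : 𝔤)

end QuadraticSubalgebra

/-- The relative cubic Dirac operator `D_{𝔤,𝔩} = D_𝔤 - j(D_𝔩)`. -/
def relDirac {𝔩 : QuadraticSubalgebra 𝔤} {I J : Type*} [Fintype I] [Fintype J]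
    (e : HomogeneousBasis 𝔤 I) (f : HomogeneousBasis 𝔩.toSubmodule J)
    (j : Weil 𝔩.toSubmodule →ₐ[ℂ] Weil 𝔤) : Weil 𝔤 :=
  e.dirac - j f.dirac

end Relative

end

end SuperWeil

namespace SuperWeil

open LieSuperalgebra QuadraticLieSuperalgebra

/-! ### Homogeneous elements and dual bases -/

section Bases

variable {𝔤 : Type*} [AddCommGroup 𝔤] [Module ℂ 𝔤]

/-! The argument rests on three facts about `D = D_𝔤`. The anticommutator of `D` with `1 ⊗ x` is `2
γ^𝒲(x)` (`dirac_mul_right`), `D` commutes with `γ^𝒲(x)` (`gammaW_mul_dirac`), and `D² = Ω +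
str(Ω)/24` (`dirac_sq`).

No parity signs occur in the first two facts, because `D` is even for the parity of `𝔤` and odd for
the length of Clifford words. They follow from the invariance of the canonical tensor `∑ eᵃ ⊗ eₐ`
and from `φ' = -1/6 ∑ eᵃ γ'(eₐ)`. In the square, the cross terms with `φ'` cancel what `(∑ eᵃ ⊗
eₐ)²` contributes beyond `Ω`. What is left is `φ'²`, which is `1/12` of the Casimir element of the
spin representation. That element is the scalar `str(Ω)/2`, as computing `∑ eᶜ C e_c` in two ways
shows (`sum_gamma_mul_gamma`).

The map `j` exists because `γ^𝒲(x)` and `-1/2 γ'_𝔩(x)` act on `Cl(𝔩)` by the same derivation `ad x`.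
Their difference, the image of `x ⊗ 1`, therefore supercommutes with `Cl(𝔩)` and satisfies the
relations of `𝔘(𝔩)`. Subtracting the first two facts for `𝔩` from those for `𝔤`, one finds that
`D_{𝔤,𝔩}` anticommutes with `1 ⊗ x` and commutes with `γ^𝒲(x)` for `x ∈ 𝔩`. Hence it anticommutes
with `j(D_𝔩)`, so `D_𝔤² = D_{𝔤,𝔩}² + j(D_𝔩²)`, which is b).

For a), on elements of even parity and odd length `L_x` is the commutator with `γ^𝒲(x)` and `2ι_x`
is the anticommutator with `1 ⊗ x`, so both vanish on `D_{𝔤,𝔩}`. Its linear part lies in `𝔘(𝔤) ⊗ 𝔭`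
by orthogonal projection. Its Clifford part is killed by the contractions with `𝔩`, and a number
operator argument (`mem_clOrth_of_contraction`) places it in `Cl(𝔭)`. -/

theorem exists_par_add [LieSuperalgebra 𝔤] (x : 𝔤) :
    ∃ y ∈ par (𝔤 := 𝔤) 0, ∃ z ∈ par (𝔤 := 𝔤) 1, x = y + z := by
  obtain ⟨a, ha, b, hb, h⟩ := Submodule.mem_sup.1
    ((isCompl : IsCompl (par (𝔤 := 𝔤) 0) (par 1)).sup_eq_top ▸ Submodule.mem_top : x ∈ _)
  exact ⟨a, ha, b, hb, h.symm⟩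

/-- An additive property of vectors may be checked on homogeneous vectors. -/
theorem par_induction [LieSuperalgebra 𝔤] {P : 𝔤 → Prop} (hadd : ∀ x y, P x → P y → P (x + y))
    (hpar : ∀ (i : ZMod 2) (x : 𝔤), x ∈ par i → P x) (x : 𝔤) : P x := by
  obtain ⟨y, hy, z, hz, rfl⟩ := exists_par_add x
  exact hadd _ _ (hpar 0 y hy) (hpar 1 z hz)

variable [QuadraticLieSuperalgebra 𝔤]

theorem eq_of_form_left {x y : 𝔤} (h : ∀ z : 𝔤, form z x = form z y) : x = y := by
  rw [← sub_eq_zero]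
  exact form_nondegenerate.2 _ fun z => by rw [map_sub, h, sub_self]

theorem form_bracket_left {p i : ZMod 2} {x y : 𝔤} (hx : x ∈ par p) (hy : y ∈ par i) (z : 𝔤) :
    form (bracket x y) z = -(sgn p i * form y (bracket x z)) := by
  rw [bracket_skew hx hy, map_neg, map_smul, LinearMap.neg_apply, LinearMap.smul_apply,
    form_invariant, smul_eq_mul]

namespace HomogeneousBasis

variable {I : Type*} (b : HomogeneousBasis 𝔤 I)

theorem form_e_dual [DecidableEq I] (a c : I) :
    form (b.e a) (b.dual c) = if a = c then 1 else 0 := by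
  split_ifs with h
  · subst h; exact b.form_self a
  · exact b.form_ne a c h

theorem eq_of_form_e {x y : 𝔤} (h : ∀ a, form (b.e a) x = form (b.e a) y) : x = y := by
  have h' : form.flip x = form.flip y := b.e.ext h
  exact eq_of_form_left fun z => LinearMap.congr_fun h' z

/-- The component of `eᵃ` of the wrong parity pairs to zero with every basis vector: with those of
its own parity because none of them is `eₐ`, with the others because the form is even. -/
theorem dual_mem (a : I) : b.dual a ∈ par (b.deg a) := by
  have key : ∀ (i j : ZMod 2), i ≠ j → ∀ y ∈ par (𝔤 := 𝔤) i, ∀ z ∈ par (𝔤 := 𝔤) j,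
      b.dual a = y + z → b.deg a = i → b.dual a ∈ par (b.deg a) := by
    rintro i j hij y hy z hz h rfl
    suffices hz0 : z = 0 by rw [h, hz0, add_zero]; exact hy
    refine b.eq_of_form_e fun c => ?_
    rw [map_zero]
    by_cases hc : b.deg c = j
    · have hca : c ≠ a := by rintro rfl; exact hij hc
      have h1 := b.form_ne c a hca
      rwa [h, map_add, form_consistent (b.mem c) hy (by rw [hc]; exact hij.symm), zero_add] at h1
    · exact form_consistent (b.mem c) hz hc
  obtain ⟨y, hy, z, hz, h⟩ := exists_par_add (b.dual a)
  rcases zmod2_cases (b.deg a) with h0 | h1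
  · exact key 0 1 (by decide) y hy z hz h h0
  · exact key 1 0 (by decide) z hz y hy (by rw [h, add_comm]) h1

variable [Fintype I]

theorem repr_apply (x : 𝔤) (a : I) : b.e.repr x a = form x (b.dual a) := by
  classical
  conv_rhs => rw [← b.e.sum_repr x]
  simp [-Module.Basis.sum_repr, b.form_e_dual]

theorem sum_form_smul_e (x : 𝔤) : ∑ a, form x (b.dual a) • b.e a = x := by
  simp_rw [← repr_apply]
  exact b.e.sum_repr x

theorem sum_form_smul_dual (x : 𝔤) : ∑ a, form (b.e a) x • b.dual a = x := by
  classical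
  refine b.eq_of_form_e fun c => ?_
  simp [b.form_e_dual]

variable {M : Type*} [AddCommGroup M] [Module ℂ M] (F : 𝔤 →ₗ[ℂ] 𝔤 →ₗ[ℂ] M)

/-- Moving an operator across the canonical tensor `∑ eᵃ ⊗ eₐ` to its adjoint. -/
theorem sum_adjoint (u v : I → 𝔤) (h : ∀ a c, form (v a) (b.dual c) = form (b.e a) (u c)) :
    ∑ a, F (b.dual a) (v a) = ∑ a, F (u a) (b.e a) := by
  calc ∑ a, F (b.dual a) (v a)
      = ∑ a, ∑ c, form (b.e a) (u c) • F (b.dual a) (b.e c) := by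
        refine Finset.sum_congr rfl fun a _ => ?_
        conv_lhs => rw [← b.sum_form_smul_e (v a)]
        simp [h]
    _ = ∑ c, F (u c) (b.e c) := by
        rw [Finset.sum_comm]
        refine Finset.sum_congr rfl fun c _ => ?_
        conv_rhs => rw [← b.sum_form_smul_dual (u c)]
        simp

/-- Invariance of the canonical tensor, in a form without signs. -/
theorem sum_bracket_right (x : 𝔤) :
    ∑ a, F (b.dual a) (bracket (b.e a) x) = ∑ a, F (bracket x (b.dual a)) (b.e a) :=
  b.sum_adjoint F _ _ fun _ _ => form_invariant _ _ _

/-- Invariance of the canonical tensor under `ad x`. -/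
theorem sum_bracket_left {p : ZMod 2} {x : 𝔤} (hx : x ∈ par p) :
    ∑ a, sgn p (b.deg a) • F (b.dual a) (bracket x (b.e a)) =
      -∑ a, F (bracket x (b.dual a)) (b.e a) := by
  rw [← b.sum_bracket_right, ← Finset.sum_neg_distrib]
  refine Finset.sum_congr rfl fun a _ => ?_
  rw [bracket_skew (b.mem a) hx, map_neg, map_smul, sgn_comm, neg_neg]

/-- The canonical tensor is supersymmetric. -/
theorem sum_flip : ∑ a, sgn (b.deg a) (b.deg a) • F (b.e a) (b.dual a) =
    ∑ a, F (b.dual a) (b.e a) := by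
  -- The pairing vanishes unless the parities agree, so the sign of supersymmetry can be made to
  -- depend on `c` alone and leaves the sum over `a`.
  have h : ∀ a c, form (b.dual a) (b.dual c) =
      sgn (b.deg c) (b.deg c) * form (b.dual c) (b.dual a) := by
    intro a c
    by_cases hac : b.deg a = b.deg c
    · rw [form_supersymm (b.dual_mem a) (b.dual_mem c), hac]
    · rw [form_consistent (b.dual_mem a) (b.dual_mem c) hac,
        form_consistent (b.dual_mem c) (b.dual_mem a) (Ne.symm hac), mul_zero]
  symm
  calc ∑ a, F (b.dual a) (b.e a)
      = ∑ a, ∑ c, form (b.dual a) (b.dual c) • F (b.e c) (b.e a) := by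
        refine Finset.sum_congr rfl fun a _ => ?_
        conv_lhs => rw [← b.sum_form_smul_e (b.dual a)]
        simp
    _ = _ := by
        rw [Finset.sum_comm]
        refine Finset.sum_congr rfl fun c _ => ?_
        conv_rhs => rw [← b.sum_form_smul_e (b.dual c)]
        simp only [map_sum, map_smul, Finset.smul_sum, smul_smul, ← h]

/-- The canonical tensor is supersymmetric and the bracket is super-skew, so the sum equals its own
negative. This is why the lower order terms of the quantizations `γ'` and `φ'` vanish. -/
theorem sum_bracket_dual_e : ∑ a, bracket (b.dual a) (b.e a) = 0 := by
  have h := b.sum_flip (bracket (𝔤 := 𝔤))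
  have h' : ∑ a, sgn (b.deg a) (b.deg a) • bracket (b.e a) (b.dual a) =
      -∑ a, bracket (b.dual a) (b.e a) := by
    rw [← Finset.sum_neg_distrib]
    refine Finset.sum_congr rfl fun a _ => ?_
    rw [bracket_skew (b.mem a) (b.dual_mem a), smul_neg, smul_smul, sgn_mul_self, one_smul]
  rw [h'] at h
  have h2 : (2 : ℂ) • ∑ a, bracket (b.dual a) (b.e a) = 0 := by
    rw [two_smul]
    nth_rewrite 1 [← h]
    exact neg_add_cancel _
  exact (smul_eq_zero.1 h2).resolve_left two_ne_zero

theorem sum_form_bracket_dual_e (x : 𝔤) : ∑ a, form (bracket x (b.dual a)) (b.e a) = 0 := by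
  simp_rw [form_invariant]
  rw [← map_sum, b.sum_bracket_dual_e, map_zero]

end HomogeneousBasis

end Bases

/-! ### Quantization of bivectors and trivectors -/

section Quantization

variable {𝔤 : Type*} [AddCommGroup 𝔤] [Module ℂ 𝔤] [QuadraticLieSuperalgebra 𝔤]

theorem Cl.ι_mul_ι_eq {i j : ZMod 2} {x y : 𝔤} (hx : x ∈ par i) (hy : y ∈ par j) :
    Cl.ι x * Cl.ι y = (2 * form x y) • 1 - sgn i j • (Cl.ι y * Cl.ι x) := by
  rw [eq_sub_iff_add_eq, Cl.ι_mul_ι hx hy, Algebra.algebraMap_eq_smul_one]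

theorem Cl.sgn_smul_ι_mul_ι {i j : ZMod 2} {x y : 𝔤} (hx : x ∈ par i) (hy : y ∈ par j) :
    sgn i j • (Cl.ι y * Cl.ι x) = (2 * form x y) • 1 - Cl.ι x * Cl.ι y := by
  rw [Cl.ι_mul_ι_eq hx hy, sub_sub_cancel]

theorem quantization_two {i j : ZMod 2} {x y : 𝔤} (hx : x ∈ par i) (hy : y ∈ par j) :
    quantization ![i, j] ![x, y] = Cl.ι x * Cl.ι y - form x y • 1 := by
  have hu : (Finset.univ : Finset (Equiv.Perm (Fin 2))) = {1, Equiv.swap 0 1} := by decide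
  have h1 : koszulSign 1 ![i, j] = 1 := by
    simp (decide := true) [koszulSign, Fin.prod_univ_two]
  have h2 : koszulSign (Equiv.swap 0 1) ![i, j] = -sgn i j := by
    simp [koszulSign, Fin.prod_univ_two]
  rw [quantization, hu, Finset.sum_insert (by decide), Finset.sum_singleton, h1, h2]
  simp only [List.ofFn_succ, List.ofFn_zero, List.prod_cons, List.prod_nil, mul_one]
  simp only [Equiv.Perm.one_apply, Fin.succ_zero_eq_one, Equiv.swap_apply_left,
    Equiv.swap_apply_right, Matrix.cons_val_zero, Matrix.cons_val_one, neg_smul,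
    Cl.sgn_smul_ι_mul_ι hx hy]
  simp [Nat.factorial]
  module

/-- Each of the six words is brought to the order `xyz` by Clifford relations. The Koszul signs make
the leading terms add up, and each contraction is collected with total weight `6`. -/
theorem quantization_three {i j k : ZMod 2} {x y z : 𝔤} (hx : x ∈ par i) (hy : y ∈ par j)
    (hz : z ∈ par k) :
    quantization ![i, j, k] ![x, y, z] = Cl.ι x * Cl.ι y * Cl.ι z - form x y • Cl.ι z -
      form y z • Cl.ι x + (sgn i j * form x z) • Cl.ι y := by
  have hu : (Finset.univ : Finset (Equiv.Perm (Fin 3))) = {1, Equiv.swap 0 1, Equiv.swap 1 2,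
    Equiv.swap 0 1 * Equiv.swap 1 2, Equiv.swap 1 2 * Equiv.swap 0 1, Equiv.swap 0 2} := by decide
  have e1 : koszulSign 1 ![i, j, k] = 1 := by
    simp (decide := true) [koszulSign, Fin.prod_univ_three]
  have e2 : koszulSign (Equiv.swap 0 1) ![i, j, k] = -sgn i j := by
    simp (decide := true) [koszulSign, Fin.prod_univ_three]
  have e3 : koszulSign (Equiv.swap 1 2) ![i, j, k] = -sgn j k := by
    simp (decide := true) [koszulSign, Fin.prod_univ_three]
  have e4 : koszulSign (Equiv.swap 0 1 * Equiv.swap 1 2) ![i, j, k] = sgn i j * sgn i k := by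
    simp (decide := true) [koszulSign, Fin.prod_univ_three]
  have e5 : koszulSign (Equiv.swap 1 2 * Equiv.swap 0 1) ![i, j, k] = sgn i k * sgn j k := by
    simp (decide := true) [koszulSign, Fin.prod_univ_three]
  have e6 : koszulSign (Equiv.swap 0 2) ![i, j, k] = -(sgn i j * sgn i k * sgn j k) := by
    simp (decide := true) [koszulSign, Fin.prod_univ_three]
  have hxy := Cl.sgn_smul_ι_mul_ι hx hy
  have hyz := Cl.sgn_smul_ι_mul_ι hy hz
  have hxz := Cl.sgn_smul_ι_mul_ι hx hz
  have w2 : sgn i j • (Cl.ι y * (Cl.ι x * Cl.ι z)) =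
      (2 * form x y) • Cl.ι z - Cl.ι x * (Cl.ι y * Cl.ι z) := by
    rw [← mul_assoc, ← smul_mul_assoc, hxy, sub_mul, smul_one_mul, mul_assoc]
  have w3 : sgn j k • (Cl.ι x * (Cl.ι z * Cl.ι y)) =
      (2 * form y z) • Cl.ι x - Cl.ι x * (Cl.ι y * Cl.ι z) := by
    rw [← mul_smul_comm, hyz, mul_sub, mul_smul_comm, mul_one]
  have w4 : (sgn i j * sgn i k) • (Cl.ι y * (Cl.ι z * Cl.ι x)) =
      (sgn i j * (2 * form x z)) • Cl.ι y - (2 * form x y) • Cl.ι z +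
        Cl.ι x * (Cl.ι y * Cl.ι z) := by
    rw [mul_smul, ← mul_smul_comm (sgn i k), hxz, mul_sub, mul_smul_comm, mul_one, smul_sub, w2,
      smul_smul]
    abel
  have w5 : (sgn i k * sgn j k) • (Cl.ι z * (Cl.ι x * Cl.ι y)) =
      (sgn j k * (2 * form x z)) • Cl.ι y - (2 * form y z) • Cl.ι x +
        Cl.ι x * (Cl.ι y * Cl.ι z) := by
    rw [mul_comm (sgn i k), mul_smul, ← mul_assoc, ← smul_mul_assoc (sgn i k), hxz, sub_mul,
      smul_one_mul, mul_assoc, smul_sub, w3, smul_smul]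
    abel
  have w6 : (sgn i j * sgn i k * sgn j k) • (Cl.ι z * (Cl.ι y * Cl.ι x)) =
      (sgn i j * sgn i k * (2 * form y z)) • Cl.ι x -
        (sgn i j * sgn i k) • (Cl.ι y * (Cl.ι z * Cl.ι x)) := by
    rw [mul_smul, ← mul_assoc, ← smul_mul_assoc (sgn j k), hyz, sub_mul, smul_one_mul, mul_assoc,
      smul_sub, smul_smul]
  -- The remaining signs are absorbed by the form, which pairs only vectors of equal parity.
  have f1 : sgn i j * sgn i k * form y z = form y z := sgn_mul_form i hy hz
  have f2 : sgn j k * form x z = sgn i j * form x z := by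
    by_cases h : i = k
    · rw [h, sgn_comm]
    · rw [form_consistent hx hz h, mul_zero, mul_zero]
  rw [quantization, hu, Finset.sum_insert (by decide), Finset.sum_insert (by decide),
    Finset.sum_insert (by decide), Finset.sum_insert (by decide), Finset.sum_insert (by decide),
    Finset.sum_singleton, e1, e2, e3, e4, e5, e6]
  simp only [List.ofFn_succ, List.ofFn_zero, List.prod_cons, List.prod_nil, mul_one]
  have a1 : (Equiv.swap (0 : Fin 3) 1) 2 = 2 := by decide
  have a2 : (Equiv.swap (1 : Fin 3) 2) 0 = 0 := by decide
  have a3 : (Equiv.swap (0 : Fin 3) 2) 1 = 1 := by decide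
  have s2 : (Fin.succ (Fin.succ 0) : Fin 3) = 2 := rfl
  have s1 : (Fin.succ 0 : Fin 3) = 1 := rfl
  simp only [s1, s2, Equiv.Perm.one_apply, Equiv.Perm.mul_apply, a1, a2, a3,
    Equiv.swap_apply_left, Equiv.swap_apply_right, Matrix.cons_val_zero, Matrix.cons_val_one,
    Matrix.cons_val, neg_smul, w2, w3, w5, w6, w4]
  rw [show sgn i j * sgn i k * (2 * form y z) = 2 * form y z by linear_combination 2 * f1,
    show sgn j k * (2 * form x z) = 2 * (sgn i j * form x z) by linear_combination 2 * f2,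
    show sgn i j * (2 * form x z) = 2 * (sgn i j * form x z) by ring]
  simp only [Nat.factorial]
  rw [mul_assoc]
  push_cast
  module

end Quantization

/-! ### The spin representation and the cubic element -/

section Spin

variable {𝔤 : Type*} [AddCommGroup 𝔤] [Module ℂ 𝔤] [QuadraticLieSuperalgebra 𝔤]

/-- The bilinear map `(x, y) ↦ f x * g y`. -/
noncomputable def bilinMul {V W A : Type*} [AddCommGroup V] [Module ℂ V] [AddCommGroup W]
    [Module ℂ W] [Ring A] [Algebra ℂ A] (f : V →ₗ[ℂ] A) (g : W →ₗ[ℂ] A) : V →ₗ[ℂ] W →ₗ[ℂ] A :=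
  (LinearMap.mul ℂ A).compl₁₂ f g

@[simp]
theorem bilinMul_apply {V W A : Type*} [AddCommGroup V] [Module ℂ V] [AddCommGroup W]
    [Module ℂ W] [Ring A] [Algebra ℂ A] (f : V →ₗ[ℂ] A) (g : W →ₗ[ℂ] A) (x : V) (y : W) :
    bilinMul f g x y = f x * g y := rfl

namespace HomogeneousBasis

variable {I : Type*} [Fintype I] (b : HomogeneousBasis 𝔤 I)

/-- The linear map `x ↦ -1/2 ∑ₐ [x, eᵃ] eₐ` to the Clifford superalgebra; it agrees with `γ'` on
homogeneous elements. -/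
noncomputable def gamma : 𝔤 →ₗ[ℂ] Cl 𝔤 :=
  (-(1 / 2) : ℂ) • ∑ a, (bilinMul Cl.ι Cl.ι).flip (b.e a) ∘ₗ bracket.flip (b.dual a)

theorem gamma_apply (x : 𝔤) : b.gamma x =
    (-(1 / 2) : ℂ) • ∑ a, Cl.ι (bracket x (b.dual a)) * Cl.ι (b.e a) := by
  simp [gamma]

theorem sum_bracket_mul (x : 𝔤) :
    ∑ a, Cl.ι (bracket x (b.dual a)) * Cl.ι (b.e a) = (-2 : ℂ) • b.gamma x := by
  rw [gamma_apply, smul_smul]; norm_num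

theorem sum_dual_mul_bracket (x : 𝔤) :
    ∑ a, Cl.ι (b.dual a) * Cl.ι (bracket (b.e a) x) = (-2 : ℂ) • b.gamma x := by
  rw [← sum_bracket_mul]
  exact b.sum_bracket_right (bilinMul Cl.ι Cl.ι) x

/-- The scalar correction of the quantization is `∑ B([x,eᵃ],eₐ) = 0`. This makes `γ'` available as
a linear map with no reference to parities. -/
theorem gammaPrime_eq {p : ZMod 2} {x : 𝔤} (hx : x ∈ par p) : b.gammaPrime p x = b.gamma x := by
  rw [gammaPrime, gamma_apply]
  simp_rw [quantization_two (bracket_mem hx (b.dual_mem _)) (b.mem _), Finset.sum_sub_distrib,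
    ← Finset.sum_smul, b.sum_form_bracket_dual_e, zero_smul, sub_zero]

/-- Summing over the third index turns `f_{abc} eᶜ` into the vector `[eₐ,e_b]`. The three
contraction terms contain `∑ [eᵃ,eₐ]` or its pairing and vanish; the cubic term sums over `b` to `2
eᵃ γ'(eₐ)`, whence `-2/12 = -1/6`. -/
theorem phiPrime_eq :
    b.phiPrime = (-(1 / 6) : ℂ) • ∑ a, Cl.ι (b.dual a) * b.gamma (b.e a) := by
  -- The factor `(-1)^(p(e_c))` in `φ` is what exchanges the arguments of the form here.
  have hk : ∀ w : 𝔤, ∑ k, (sgn 1 (b.deg k) * form w (b.e k)) • b.dual k = w := by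
    intro w
    conv_rhs => rw [← b.sum_form_smul_dual w]
    refine Finset.sum_congr rfl fun k _ => ?_
    congr 1
    induction w using par_induction with
    | hadd x y hx hy => rw [map_add, LinearMap.add_apply, mul_add, hx, hy, map_add]
    | hpar i x hx =>
      rw [form_supersymm (b.mem k) hx]
      by_cases h : i = b.deg k
      · rw [h]
        congr 1
        rcases zmod2_cases (b.deg k) with h | h <;> simp [h, sgn]
      · rw [form_consistent hx (b.mem k) h, mul_zero, mul_zero]
  have hq : ∀ i j, ∑ k, (sgn (b.deg i) (b.deg j) * sgn 1 (b.deg k) *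
      form (bracket (b.e i) (b.e j)) (b.e k)) •
        quantization ![b.deg i, b.deg j, b.deg k] ![b.dual i, b.dual j, b.dual k] =
      sgn (b.deg i) (b.deg j) • (Cl.ι (b.dual i) * Cl.ι (b.dual j) *
          Cl.ι (bracket (b.e i) (b.e j)) -
        form (b.dual i) (b.dual j) • Cl.ι (bracket (b.e i) (b.e j)) -
        form (b.dual j) (bracket (b.e i) (b.e j)) • Cl.ι (b.dual i) +
        (sgn (b.deg i) (b.deg j) * form (b.dual i) (bracket (b.e i) (b.e j))) •
          Cl.ι (b.dual j)) := by
    intro i j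
    set w := bracket (b.e i) (b.e j)
    conv_rhs => rw [← hk w]
    simp only [map_sum, map_smul, Finset.mul_sum, Finset.smul_sum, Finset.sum_smul,
      ← Finset.sum_sub_distrib, ← Finset.sum_add_distrib, smul_eq_mul]
    refine Finset.sum_congr rfl fun k _ => ?_
    rw [quantization_three (b.dual_mem i) (b.dual_mem j) (b.dual_mem k), mul_smul_comm]
    module
  have t1 : ∑ i, ∑ j, sgn (b.deg i) (b.deg j) •
      form (b.dual i) (b.dual j) • Cl.ι (bracket (b.e i) (b.e j)) = 0 := by
    calc _ = ∑ i, sgn (b.deg i) (b.deg i) • Cl.ι (bracket (b.e i) (b.dual i)) := by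
          refine Finset.sum_congr rfl fun i _ => ?_
          conv_rhs => rw [← b.sum_form_smul_e (b.dual i)]
          simp only [map_sum, map_smul, Finset.smul_sum]
          refine Finset.sum_congr rfl fun j _ => ?_
          by_cases h : b.deg i = b.deg j
          · rw [h]
          · rw [form_consistent (b.dual_mem i) (b.dual_mem j) h, zero_smul, smul_zero, smul_zero]
      _ = Cl.ι (∑ i, bracket (b.dual i) (b.e i)) := by
          rw [← b.sum_flip (bracket (𝔤 := 𝔤))]
          simp
      _ = 0 := by rw [b.sum_bracket_dual_e, map_zero]
  have t2 : ∑ i, ∑ j, sgn (b.deg i) (b.deg j) •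
      form (b.dual j) (bracket (b.e i) (b.e j)) • Cl.ι (b.dual i) = 0 := by
    refine Finset.sum_eq_zero fun i _ => ?_
    simp_rw [smul_smul, ← Finset.sum_smul]
    have h := b.sum_bracket_left (form (𝔤 := 𝔤)) (b.mem i)
    simp only [smul_eq_mul] at h
    rw [h, b.sum_form_bracket_dual_e, neg_zero, zero_smul]
  have t3 : ∑ i, ∑ j, sgn (b.deg i) (b.deg j) •
      (sgn (b.deg i) (b.deg j) * form (b.dual i) (bracket (b.e i) (b.e j))) •
          Cl.ι (b.dual j) = 0 := by
    rw [Finset.sum_comm]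
    refine Finset.sum_eq_zero fun j _ => ?_
    simp_rw [smul_smul, ← mul_assoc, sgn_mul_self, one_mul, ← Finset.sum_smul]
    rw [b.sum_bracket_right form, b.sum_form_bracket_dual_e, zero_smul]
  rw [phiPrime]
  simp_rw [hq, smul_add, smul_sub, Finset.sum_add_distrib, Finset.sum_sub_distrib]
  rw [t1, t2, t3, sub_zero, sub_zero, add_zero]
  -- Invariance under `ad eᵢ` moves the bracket onto the dual vector, which gives the sum defining
  -- `γ'(eᵢ)`.
  have h : ∀ i, ∑ j, sgn (b.deg i) (b.deg j) • (Cl.ι (b.dual i) * Cl.ι (b.dual j) *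
      Cl.ι (bracket (b.e i) (b.e j))) = (2 : ℂ) • (Cl.ι (b.dual i) * b.gamma (b.e i)) := by
    intro i
    have := b.sum_bracket_left (bilinMul Cl.ι Cl.ι) (b.mem i)
    simp only [bilinMul_apply, b.sum_bracket_mul] at this
    simp_rw [mul_assoc, ← mul_smul_comm, ← Finset.mul_sum]
    simp only [← mul_smul_comm] at this
    rw [this]
    congr 1
    module
  simp_rw [h, ← Finset.smul_sum, smul_smul]
  norm_num

/-- `-1/2 γ'(x)` acts on generators as `ad x`. -/
theorem gamma_mul_ι {p i : ZMod 2} {x y : 𝔤} (hx : x ∈ par p) (hy : y ∈ par i) :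
    b.gamma x * Cl.ι y = sgn p i • (Cl.ι y * b.gamma x) - (2 : ℂ) • Cl.ι (bracket x y) := by
  -- Moving `y` to the left past both factors leaves one contraction with each. Summed over `a` they
  -- give `2[x,y]` and `-2(-1)^(p(x)p(y))[y,x]`, together `4[x,y]`.
  have key : ∀ a, Cl.ι (bracket x (b.dual a)) * Cl.ι (b.e a) * Cl.ι y =
      (2 : ℂ) • Cl.ι (bracket x (form (b.e a) y • b.dual a)) -
        (2 * sgn p i) • Cl.ι (form (bracket y x) (b.dual a) • b.e a) +
        sgn p i • (Cl.ι y * (Cl.ι (bracket x (b.dual a)) * Cl.ι (b.e a))) := by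
    intro a
    have hb := bracket_mem hx (b.dual_mem a)
    have e1 := Cl.ι_mul_ι_eq (b.mem a) hy
    have e2 := Cl.ι_mul_ι_eq hb hy
    have hf : sgn (b.deg a) i * form (bracket x (b.dual a)) y =
        sgn p i * form (bracket y x) (b.dual a) := by
      rw [form_supersymm hb hy, sgn_add_left, form_invariant, ← mul_assoc, mul_comm (sgn p i),
        ← mul_assoc, sgn_mul_self, one_mul]
    rw [mul_assoc, e1, mul_sub, mul_smul_comm, mul_smul_comm, mul_one, ← mul_assoc, e2, sub_mul,
      smul_one_mul, smul_mul_assoc, mul_assoc, sgn_add_left, smul_sub, smul_smul, smul_smul]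
    rw [show sgn (b.deg a) i * (2 * form (bracket x (b.dual a)) y) =
      2 * sgn p i * form (bracket y x) (b.dual a) by linear_combination 2 * hf,
      show sgn (b.deg a) i * (sgn p i * sgn (b.deg a) i) = sgn p i by
        linear_combination sgn p i * sgn_mul_self (b.deg a) i]
    simp only [map_smul]
    module
  have h : (∑ a, Cl.ι (bracket x (b.dual a)) * Cl.ι (b.e a)) * Cl.ι y =
      (4 : ℂ) • Cl.ι (bracket x y) +
        sgn p i • (Cl.ι y * ∑ a, Cl.ι (bracket x (b.dual a)) * Cl.ι (b.e a)) := by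
    rw [Finset.sum_mul, Finset.sum_congr rfl fun a _ => key a]
    simp only [Finset.sum_add_distrib, Finset.sum_sub_distrib, ← Finset.smul_sum, ← map_sum,
      ← Finset.mul_sum, b.sum_form_smul_dual, b.sum_form_smul_e]
    rw [bracket_skew hy hx, sgn_comm, map_neg, map_smul, smul_neg, smul_smul, mul_assoc,
      sgn_mul_self]
    module
  rw [b.sum_bracket_mul, smul_mul_assoc, mul_smul_comm] at h
  have h2 := congrArg (fun z => (-(1 / 2) : ℂ) • z) h
  simp only [smul_smul, smul_add] at h2
  norm_num at h2
  rw [h2]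
  module

variable {A : Type*} [Ring A] [Algebra ℂ A] (h : Cl 𝔤 →ₐ[ℂ] A)

/-- An element that acts on the generators of `Cl(𝔤)` as `ad x` acts on `γ'` as `ad x`. -/
theorem mul_map_gamma {p : ZMod 2} {x : 𝔤} (hx : x ∈ par p) {X : A}
    (hX : ∀ (i : ZMod 2) (y : 𝔤), y ∈ par i → X * h (Cl.ι y) =
      sgn p i • (h (Cl.ι y) * X) + h (Cl.ι (bracket x y)))
    {i : ZMod 2} {y : 𝔤} (hy : y ∈ par i) :
    X * h (b.gamma y) = sgn p i • (h (b.gamma y) * X) + h (b.gamma (bracket x y)) := by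
  have key : ∀ a, X * h (Cl.ι (bracket y (b.dual a)) * Cl.ι (b.e a)) =
      sgn p i • (h (Cl.ι (bracket y (b.dual a)) * Cl.ι (b.e a)) * X) +
      (sgn p i • h (sgn p (b.deg a) • (Cl.ι (bracket y (b.dual a)) * Cl.ι (bracket x (b.e a)))) +
        h (Cl.ι (bracket x (bracket y (b.dual a))) * Cl.ι (b.e a))) := by
    intro a
    rw [map_mul, ← mul_assoc, hX _ _ (bracket_mem hy (b.dual_mem a)), add_mul, smul_mul_assoc,
      mul_assoc, hX _ _ (b.mem a), sgn_add_right, map_smul, map_mul, map_mul, mul_add,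
      mul_smul_comm, smul_add, smul_smul, mul_assoc (sgn p i), sgn_mul_self, mul_one, mul_assoc]
    module
  -- After Jacobi, the term with `[y,[x,eᵃ]]` cancels the one in which `x` acts on `eₐ`; only
  -- `[[x,y],eᵃ]` survives.
  have hinv := b.sum_bracket_left (bilinMul (Cl.ι ∘ₗ bracket y) Cl.ι) hx
  simp only [bilinMul_apply, LinearMap.comp_apply] at hinv
  have hj : ∑ a, Cl.ι (bracket x (bracket y (b.dual a))) * Cl.ι (b.e a) =
      ∑ a, Cl.ι (bracket (bracket x y) (b.dual a)) * Cl.ι (b.e a) +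
        sgn p i • ∑ a, Cl.ι (bracket y (bracket x (b.dual a))) * Cl.ι (b.e a) := by
    rw [Finset.smul_sum, ← Finset.sum_add_distrib]
    refine Finset.sum_congr rfl fun a _ => ?_
    rw [jacobi _ hx hy, map_add, map_smul, add_mul, smul_mul_assoc]
  simp only [gamma_apply, map_smul, mul_smul_comm, smul_mul_assoc, map_sum, Finset.mul_sum,
    Finset.sum_mul]
  rw [Finset.sum_congr rfl fun a _ => key a]
  simp only [Finset.sum_add_distrib, ← Finset.smul_sum, ← map_sum]
  rw [hinv, hj]
  simp only [map_add, map_smul, map_neg]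
  module

/-- `φ'` is the image of the invariant canonical tensor under the equivariant map `y ⊗ z ↦ y γ'(z)`,
and it is even, so no sign appears. The target `A` is left free because `X` is needed both in
`Cl(𝔤)` and in `𝒲(𝔤)`. -/
theorem mul_map_phiPrime {p : ZMod 2} {x : 𝔤} (hx : x ∈ par p) {X : A}
    (hX : ∀ (i : ZMod 2) (y : 𝔤), y ∈ par i → X * h (Cl.ι y) =
      sgn p i • (h (Cl.ι y) * X) + h (Cl.ι (bracket x y))) :
    X * h b.phiPrime = h b.phiPrime * X := by
  have key : ∀ a, X * h (Cl.ι (b.dual a) * b.gamma (b.e a)) =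
      h (Cl.ι (b.dual a) * b.gamma (b.e a)) * X +
      (h (sgn p (b.deg a) • (Cl.ι (b.dual a) * b.gamma (bracket x (b.e a)))) +
        h (Cl.ι (bracket x (b.dual a)) * b.gamma (b.e a))) := by
    intro a
    rw [map_mul, ← mul_assoc, hX _ _ (b.dual_mem a), add_mul, smul_mul_assoc,
      mul_assoc, b.mul_map_gamma h hx hX (b.mem a), map_smul, map_mul, map_mul, mul_add,
      mul_smul_comm, smul_add, smul_smul, sgn_mul_self, mul_assoc]
    module
  have hinv := b.sum_bracket_left (bilinMul Cl.ι b.gamma) hx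
  simp only [bilinMul_apply] at hinv
  rw [phiPrime_eq]
  simp only [map_smul, mul_smul_comm, smul_mul_assoc, map_sum, Finset.mul_sum,
    Finset.sum_mul]
  rw [Finset.sum_congr rfl fun a _ => key a]
  simp only [Finset.sum_add_distrib, ← map_sum]
  rw [hinv, map_neg, neg_add_cancel, add_zero]

theorem half_gamma_mul_ι {p i : ZMod 2} {x y : 𝔤} (hx : x ∈ par p) (hy : y ∈ par i) :
    ((-(1 / 2) : ℂ) • b.gamma x) * Cl.ι y =
      sgn p i • (Cl.ι y * ((-(1 / 2) : ℂ) • b.gamma x)) + Cl.ι (bracket x y) := by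
  rw [smul_mul_assoc, b.gamma_mul_ι hx hy, mul_smul_comm]
  module

/-- `γ'` represents `𝔤` up to the factor `-2`. -/
theorem gamma_mul_gamma {p i : ZMod 2} {x y : 𝔤} (hx : x ∈ par p) (hy : y ∈ par i) :
    b.gamma x * b.gamma y =
      sgn p i • (b.gamma y * b.gamma x) - (2 : ℂ) • b.gamma (bracket x y) := by
  have h := b.mul_map_gamma (AlgHom.id ℂ (Cl 𝔤)) hx
    (fun i y hy => b.half_gamma_mul_ι hx hy) hy
  simp only [AlgHom.id_apply, smul_mul_assoc, mul_smul_comm] at h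
  have h2 := congrArg (fun z => (-2 : ℂ) • z) h
  simp only [smul_smul, smul_add] at h2
  norm_num at h2
  rw [h2]
  module

theorem gamma_mul_phiPrime (x : 𝔤) : b.gamma x * b.phiPrime = b.phiPrime * b.gamma x := by
  induction x using par_induction with
  | hadd x y hx hy => rw [map_add, add_mul, mul_add, hx, hy]
  | hpar p x hx =>
    have h := b.mul_map_phiPrime (AlgHom.id ℂ (Cl 𝔤)) hx
      (fun i y hy => b.half_gamma_mul_ι hx hy)
    simp only [AlgHom.id_apply, smul_mul_assoc, mul_smul_comm] at h
    exact smul_right_injective _ (by norm_num : (-(1 / 2) : ℂ) ≠ 0) h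

/-- Moving `x` through `∑ eᵃ γ'(eₐ)` yields `2γ'(x)` from the first factor and `4γ'(x)` from the
second; the total `6` cancels the `1/6` in `φ'`. The sign comes from the odd word length and not
from parity. -/
theorem phiPrime_mul_ι (x : 𝔤) :
    b.phiPrime * Cl.ι x = -(Cl.ι x * b.phiPrime) - b.gamma x := by
  induction x using par_induction with
  | hadd x y hx hy => rw [map_add, add_mul, mul_add, hx, hy, map_add]; abel
  | hpar p x hx =>
    have key : ∀ a, Cl.ι (b.dual a) * b.gamma (b.e a) * Cl.ι x =
        (2 : ℂ) • b.gamma (form x (b.dual a) • b.e a) -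
          Cl.ι x * (Cl.ι (b.dual a) * b.gamma (b.e a)) -
          (2 : ℂ) • (Cl.ι (b.dual a) * Cl.ι (bracket (b.e a) x)) := by
      intro a
      rw [mul_assoc, b.gamma_mul_ι (b.mem a) hx, mul_sub, mul_smul_comm, ← mul_assoc,
        ← smul_mul_assoc, sgn_comm, Cl.sgn_smul_ι_mul_ι hx (b.dual_mem a), sub_mul, smul_one_mul,
        mul_assoc, mul_smul_comm, map_smul]
      module
    have hs : (∑ a, Cl.ι (b.dual a) * b.gamma (b.e a)) * Cl.ι x =
        (6 : ℂ) • b.gamma x - Cl.ι x * ∑ a, Cl.ι (b.dual a) * b.gamma (b.e a) := by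
      rw [Finset.sum_mul, Finset.sum_congr rfl fun a _ => key a]
      simp only [Finset.sum_sub_distrib, ← Finset.smul_sum, ← map_sum,
        ← Finset.mul_sum, b.sum_form_smul_e, b.sum_dual_mul_bracket]
      module
    rw [phiPrime_eq, smul_mul_assoc, hs, mul_smul_comm]
    module

/-- Passing `x` through `φ'` twice produces two terms in `γ'(x)` of opposite sign, which cancel
because `γ'(x)` commutes with `φ'`. -/
theorem phiPrime_sq_mul_ι (x : 𝔤) : b.phiPrime ^ 2 * Cl.ι x = Cl.ι x * b.phiPrime ^ 2 := by
  rw [sq, mul_assoc, b.phiPrime_mul_ι, mul_sub, mul_neg, ← mul_assoc, b.phiPrime_mul_ι,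
    ← b.gamma_mul_phiPrime, sub_mul, neg_mul, mul_assoc]
  abel

/-- Let `T = ∑ eᵃ γ'(eₐ) = -6φ'`. Moving `φ'` through `T` gives `φ'T = -Tφ' - ∑ γ'(eᵃ)γ'(eₐ)`, and
both products are `-6φ'²`. -/
theorem twelve_smul_phiPrime_sq :
    (12 : ℂ) • b.phiPrime ^ 2 = ∑ a, b.gamma (b.dual a) * b.gamma (b.e a) := by
  set T := ∑ a, Cl.ι (b.dual a) * b.gamma (b.e a) with hT
  have hφ : b.phiPrime = (-(1 / 6) : ℂ) • T := b.phiPrime_eq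
  have h : b.phiPrime * T = -(T * b.phiPrime) - ∑ a, b.gamma (b.dual a) * b.gamma (b.e a) := by
    rw [hT, Finset.mul_sum, Finset.sum_mul, ← Finset.sum_neg_distrib, ← Finset.sum_sub_distrib]
    refine Finset.sum_congr rfl fun a _ => ?_
    rw [← mul_assoc, b.phiPrime_mul_ι, sub_mul, neg_mul, mul_assoc, mul_assoc,
      b.gamma_mul_phiPrime]
  rw [hφ, smul_mul_assoc, mul_smul_comm] at h
  have h2 : ∑ a, b.gamma (b.dual a) * b.gamma (b.e a) = (1 / 3 : ℂ) • (T * T) := by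
    rw [eq_sub_iff_add_eq] at h
    rw [← sub_eq_zero]
    calc _ = ((-(1 / 6) : ℂ) • (T * T) + ∑ a, b.gamma (b.dual a) * b.gamma (b.e a)) -
          (1 / 6 : ℂ) • (T * T) := by module
      _ = 0 := by rw [h]; module
  rw [h2, hφ, sq, smul_mul_smul_comm, smul_smul]
  norm_num

end HomogeneousBasis
end Spin

/-! ### The square of the cubic element -/

section Square

variable {𝔤 : Type*} [AddCommGroup 𝔤] [Module ℂ 𝔤] [QuadraticLieSuperalgebra 𝔤]

theorem sgn_eq (i j : ZMod 2) : sgn i j = 1 ∨ sgn i j = -1 := by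
  unfold sgn; split_ifs <;> simp

theorem sgn_one_eq_self (i : ZMod 2) : sgn 1 i = sgn i i := by
  simp [sgn]

namespace HomogeneousBasis

variable {I : Type*} [Fintype I] (b : HomogeneousBasis 𝔤 I)

theorem ad_casimir_apply (x : 𝔤) :
    Env.ad b.casimir x = ∑ a, bracket (b.dual a) (bracket (b.e a) x) := by
  simp [casimir, Env.ad, Env.lift_ι]

theorem ad_casimir_mem {i : ZMod 2} {x : 𝔤} (hx : x ∈ par i) : Env.ad b.casimir x ∈ par i := by
  rw [ad_casimir_apply]
  refine Submodule.sum_mem _ fun a _ => ?_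
  have h := bracket_mem (b.dual_mem a) (bracket_mem (b.mem a) hx)
  rwa [← add_assoc, CharTwo.add_self_eq_zero, zero_add] at h

/-- Taking adjoints reverses the order of the two factors of `Ω`, up to a sign that supersymmetry of
the canonical tensor removes. -/
theorem form_ad_casimir {i : ZMod 2} {x : 𝔤} (hx : x ∈ par i) (y : 𝔤) :
    form (Env.ad b.casimir x) y = form x (Env.ad b.casimir y) := by
  rw [ad_casimir_apply, ad_casimir_apply, map_sum, map_sum, LinearMap.sum_apply]
  have h := b.sum_flip ((bracket (𝔤 := 𝔤)).compl₁₂ LinearMap.id (bracket.flip y) |>.compr₂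
    (form x))
  simp only [LinearMap.compr₂_apply, LinearMap.compl₁₂_apply, LinearMap.id_apply,
    LinearMap.flip_apply] at h
  rw [← h]
  refine Finset.sum_congr rfl fun a _ => ?_
  rw [form_bracket_left (b.dual_mem a) (bracket_mem (b.mem a) hx),
    form_bracket_left (b.mem a) hx, sgn_add_right, smul_eq_mul]
  linear_combination (sgn (b.deg a) (b.deg a) *
    form x (bracket (b.e a) (bracket (b.dual a) y))) * sgn_mul_self (b.deg a) i

/-- Flipping the canonical tensor produces the sign `(-1)^(p(eₐ))`, which is the parity involution
in the supertrace. -/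
theorem sum_form_ad_casimir :
    ∑ a, form (Env.ad b.casimir (b.dual a)) (b.e a) = b.strCasimir := by
  classical
  have h := b.sum_flip (form ∘ₗ Env.ad b.casimir)
  simp only [LinearMap.comp_apply] at h
  rw [← h, strCasimir, str, LinearMap.trace_eq_matrix_trace ℂ b.e, Matrix.trace]
  refine Finset.sum_congr rfl fun a _ => ?_
  rw [Matrix.diag_apply, LinearMap.toMatrix_apply, b.repr_apply, LinearMap.comp_apply,
    parity_apply (b.ad_casimir_mem (b.mem a)), map_smul, LinearMap.smul_apply, sgn_one_eq_self]

/-- Since `Ω` is self-adjoint, the tensor `∑ Ωeᵃ ⊗ eₐ` is supersymmetric. The Clifford relation then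
makes twice its product equal to twice its pairing. -/
theorem sum_ad_casimir_mul :
    ∑ a, Cl.ι (Env.ad b.casimir (b.dual a)) * Cl.ι (b.e a) = b.strCasimir • 1 := by
  have h1 := b.sum_adjoint (bilinMul Cl.ι Cl.ι) (fun a => Env.ad b.casimir (b.dual a))
    (fun a => Env.ad b.casimir (b.e a)) (fun a c => b.form_ad_casimir (b.mem a) _)
  have h2 := b.sum_flip (bilinMul Cl.ι (Cl.ι ∘ₗ Env.ad b.casimir))
  simp only [bilinMul_apply, LinearMap.comp_apply] at h1 h2
  have h3 : ∑ a, Cl.ι (Env.ad b.casimir (b.dual a)) * Cl.ι (b.e a) =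
      (2 * b.strCasimir) • 1 - ∑ a, Cl.ι (Env.ad b.casimir (b.dual a)) * Cl.ι (b.e a) := by
    conv_rhs => rw [← h1, ← h2]
    rw [← sum_form_ad_casimir, Finset.mul_sum, Finset.sum_smul, ← Finset.sum_sub_distrib]
    refine Finset.sum_congr rfl fun a _ => ?_
    exact Cl.ι_mul_ι_eq (b.ad_casimir_mem (b.dual_mem a)) (b.mem a)
  rw [eq_sub_iff_add_eq, ← two_smul ℂ, mul_smul] at h3
  exact smul_right_injective _ (two_ne_zero : (2 : ℂ) ≠ 0) h3

theorem ι_mul_gamma {p i : ZMod 2} {x y : 𝔤} (hx : x ∈ par p) (hy : y ∈ par i) :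
    Cl.ι y * b.gamma x = sgn p i • (b.gamma x * Cl.ι y + (2 : ℂ) • Cl.ι (bracket x y)) := by
  rw [b.gamma_mul_ι hx hy, sub_add_cancel, smul_smul, sgn_mul_self, one_smul]

/-- The Casimir element of the spin representation is a scalar. -/
theorem sum_gamma_mul_gamma :
    ∑ a, b.gamma (b.dual a) * b.gamma (b.e a) = (1 / 2 * b.strCasimir) • 1 := by
  set C := ∑ a, b.gamma (b.dual a) * b.gamma (b.e a) with hC
  have hcomm : ∀ x, Cl.ι x * C = C * Cl.ι x := by
    intro x
    rw [hC, ← twelve_smul_phiPrime_sq, mul_smul_comm, smul_mul_assoc, b.phiPrime_sq_mul_ι]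
  -- Centrality of `C` does not yet make it a scalar. Its value comes from computing `∑ eᶜ C e_c`
  -- twice: here by centrality, in `e2` by moving `eᶜ` and `e_c` through the factors `γ'`.
  have e1 : ∑ c, Cl.ι (b.dual c) * C * Cl.ι (b.e c) =
      C * ∑ c, Cl.ι (b.dual c) * Cl.ι (b.e c) := by
    rw [Finset.mul_sum]
    exact Finset.sum_congr rfl fun c _ => by rw [hcomm, mul_assoc]
  have key : ∀ a c, Cl.ι (b.dual c) * (b.gamma (b.dual a) * b.gamma (b.e a)) * Cl.ι (b.e c) =
      b.gamma (b.dual a) * b.gamma (b.e a) * (Cl.ι (b.dual c) * Cl.ι (b.e c)) +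
      (2 : ℂ) • (b.gamma (b.dual a) * (Cl.ι (bracket (b.e a) (b.dual c)) * Cl.ι (b.e c))) +
      (2 : ℂ) • (Cl.ι (bracket (b.dual a) (b.dual c)) * Cl.ι (b.e c) * b.gamma (b.e a)) -
      (4 : ℂ) • (sgn (b.deg a) (b.deg c) •
        (Cl.ι (bracket (b.dual a) (b.dual c)) * Cl.ι (bracket (b.e a) (b.e c)))) := by
    intro a c
    rw [← mul_assoc, b.ι_mul_gamma (b.dual_mem a) (b.dual_mem c), smul_mul_assoc, smul_mul_assoc,
      add_mul, add_mul, mul_assoc (b.gamma (b.dual a)), b.ι_mul_gamma (b.mem a) (b.dual_mem c),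
      smul_mul_assoc (2 : ℂ), smul_mul_assoc (2 : ℂ),
      mul_assoc _ (b.gamma (b.e a)), b.gamma_mul_ι (b.mem a) (b.mem c)]
    simp only [mul_add, add_mul, mul_sub, mul_smul_comm, smul_mul_assoc, smul_add, smul_sub,
      smul_smul, sgn_mul_self, mul_assoc, one_smul]
    rcases sgn_eq (b.deg a) (b.deg c) with h | h <;> rw [h] <;> module
  have inv : ∀ a, ∑ c, sgn (b.deg a) (b.deg c) •
        (Cl.ι (bracket (b.dual a) (b.dual c)) * Cl.ι (bracket (b.e a) (b.e c))) =
      -∑ c, Cl.ι (bracket (b.dual a) (bracket (b.e a) (b.dual c))) * Cl.ι (b.e c) := fun a =>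
    b.sum_bracket_left (bilinMul (Cl.ι ∘ₗ bracket (b.dual a)) Cl.ι) (b.mem a)
  -- Each of the two mixed sums contributes `2 · (-2) C`, which gives `-8C`. In the double bracket
  -- sum, invariance assembles `ad Ω`.
  have e2 : ∑ c, Cl.ι (b.dual c) * C * Cl.ι (b.e c) =
      C * (∑ c, Cl.ι (b.dual c) * Cl.ι (b.e c)) - (8 : ℂ) • C +
        (4 : ℂ) • ∑ c, Cl.ι (Env.ad b.casimir (b.dual c)) * Cl.ι (b.e c) := by
    have hΩ : ∑ c, Cl.ι (Env.ad b.casimir (b.dual c)) * Cl.ι (b.e c) =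
        ∑ a, ∑ c, Cl.ι (bracket (b.dual a) (bracket (b.e a) (b.dual c))) * Cl.ι (b.e c) := by
      rw [Finset.sum_comm]
      refine Finset.sum_congr rfl fun c _ => ?_
      rw [ad_casimir_apply, map_sum, Finset.sum_mul]
    rw [hΩ, hC]
    simp only [Finset.mul_sum, Finset.sum_mul]
    rw [Finset.sum_comm]
    simp only [Finset.sum_congr rfl fun c _ => key _ c]
    simp only [Finset.sum_add_distrib, Finset.sum_sub_distrib, ← Finset.smul_sum, inv]
    simp only [← Finset.mul_sum, ← Finset.sum_mul, b.sum_bracket_mul, smul_mul_assoc,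
      mul_smul_comm, ← Finset.smul_sum, Finset.sum_neg_distrib]
    rw [Finset.sum_comm]
    simp only [← Finset.sum_mul]
    module
  rw [e1, sum_ad_casimir_mul, sub_add_eq_add_sub, eq_sub_iff_add_eq, add_right_inj] at e2
  have h2 := congrArg (fun z => (1 / 8 : ℂ) • z) e2
  simp only [smul_smul] at h2
  rw [show (1 / 8 : ℂ) * 8 = 1 by norm_num, one_smul] at h2
  rw [h2]
  congr 1
  ring

theorem phiPrime_sq : b.phiPrime ^ 2 = (1 / 24 * b.strCasimir) • 1 := by
  have h := b.twelve_smul_phiPrime_sq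
  rw [sum_gamma_mul_gamma] at h
  have h2 := congrArg (fun z => (1 / 12 : ℂ) • z) h
  simp only [smul_smul] at h2
  rw [show (1 / 12 : ℂ) * 12 = 1 by norm_num, one_smul] at h2
  rw [h2]
  congr 1
  ring

end HomogeneousBasis
end Square

/-! ### The cubic Dirac operator -/

section CubicDirac

variable {𝔤 : Type*} [AddCommGroup 𝔤] [Module ℂ 𝔤]

/-- Translates the sign used by `GradedTensorProduct` into `sgn`. -/
theorem units_pow_smul {M : Type*} [AddCommGroup M] [Module ℂ M] (i j : ZMod 2) (m : M) :
    (-1 : ℤˣ) ^ (i * j) • m = sgn i j • m := by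
  rcases zmod2_cases i with rfl | rfl <;> rcases zmod2_cases j with rfl | rfl <;>
    simp [sgn, uzpow_one]

theorem Env.ι_mem [LieSuperalgebra 𝔤] {i : ZMod 2} {x : 𝔤} (hx : x ∈ par i) :
    Env.ι x ∈ Env.grading 𝔤 i := by
  rw [mem_eig, Env.parity, Env.lift_ι, LinearMap.comp_apply, parity_apply hx, map_smul]

variable [QuadraticLieSuperalgebra 𝔤]

theorem Cl.ι_mem {i : ZMod 2} {x : 𝔤} (hx : x ∈ par i) : Cl.ι x ∈ Cl.grading 𝔤 i := by
  rw [mem_eig, Cl.parity, Cl.lift_ι, LinearMap.comp_apply, parity_apply hx, map_smul]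

variable (𝔤) in
/-- The inclusion `u ↦ u ⊗ 1`. -/
noncomputable abbrev Weil.left : Env 𝔤 →ₐ[ℂ] Weil 𝔤 :=
  GradedTensorProduct.includeLeft (Env.grading 𝔤) (Cl.grading 𝔤)

variable (𝔤) in
/-- The inclusion `c ↦ 1 ⊗ c`. -/
noncomputable abbrev Weil.right : Cl 𝔤 →ₐ[ℂ] Weil 𝔤 :=
  GradedTensorProduct.includeRight (Env.grading 𝔤) (Cl.grading 𝔤)

theorem Weil.tmul_eq (u : Env 𝔤) (c : Cl 𝔤) : Weil.tmul u c = Weil.left 𝔤 u * Weil.right 𝔤 c :=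
  (GradedTensorProduct.tmul_one_mul_one_tmul (Env.grading 𝔤) (Cl.grading 𝔤) u c).symm

theorem Weil.tmul_one (u : Env 𝔤) : Weil.tmul u 1 = Weil.left 𝔤 u := rfl

theorem Weil.one_tmul (c : Cl 𝔤) : Weil.tmul 1 c = Weil.right 𝔤 c := rfl

theorem Weil.right_mul_left {i j : ZMod 2} {u : Env 𝔤} {c : Cl 𝔤} (hu : u ∈ Env.grading 𝔤 i)
    (hc : c ∈ Cl.grading 𝔤 j) :
    Weil.right 𝔤 c * Weil.left 𝔤 u = sgn j i • (Weil.left 𝔤 u * Weil.right 𝔤 c) := by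
  have h := GradedTensorProduct.tmul_coe_mul_coe_tmul (R := ℂ) (Env.grading 𝔤) (Cl.grading 𝔤)
    1 ⟨c, hc⟩ ⟨u, hu⟩ 1
  rw [units_pow_smul, one_mul, mul_one] at h
  rw [← Weil.tmul_eq]
  exact h

namespace HomogeneousBasis

variable {I : Type*} [Fintype I] (b : HomogeneousBasis 𝔤 I)

theorem gamma_mem {p : ZMod 2} {x : 𝔤} (hx : x ∈ par p) : b.gamma x ∈ Cl.grading 𝔤 p := by
  rw [gamma_apply]
  refine Submodule.smul_mem _ _ (Submodule.sum_mem _ fun a _ => ?_)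
  have h := SetLike.mul_mem_graded (Cl.ι_mem (bracket_mem hx (b.dual_mem a))) (Cl.ι_mem (b.mem a))
  rwa [add_assoc, CharTwo.add_self_eq_zero, add_zero] at h

theorem phiPrime_mem : b.phiPrime ∈ Cl.grading 𝔤 0 := by
  rw [phiPrime_eq]
  refine Submodule.smul_mem _ _ (Submodule.sum_mem _ fun a _ => ?_)
  have h := SetLike.mul_mem_graded (Cl.ι_mem (b.dual_mem a)) (b.gamma_mem (b.mem a))
  rwa [CharTwo.add_self_eq_zero] at h

/-- The linear map `x ↦ x ⊗ 1 - 1/2 (1 ⊗ γ'(x))`. -/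
noncomputable def gammaW : 𝔤 →ₗ[ℂ] Weil 𝔤 :=
  (Weil.left 𝔤).toLinearMap ∘ₗ Env.ι + (-(1 / 2) : ℂ) • (Weil.right 𝔤).toLinearMap ∘ₗ b.gamma

theorem gammaW_apply (x : 𝔤) : b.gammaW x =
    Weil.left 𝔤 (Env.ι x) + Weil.right 𝔤 ((-(1 / 2) : ℂ) • b.gamma x) := by
  rw [map_smul]; rfl

theorem gammaWeil_eq {p : ZMod 2} {x : 𝔤} (hx : x ∈ par p) : b.gammaWeil p x = b.gammaW x := by
  rw [gammaWeil, b.gammaPrime_eq hx, gammaW_apply, map_smul, neg_smul, ← sub_eq_add_neg]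
  rfl

/-- The summand in `Cl(𝔤)` supercommutes with `𝔘(𝔤)` and only `x ⊗ 1` acts; in `gammaW_mul_right`
the roles are exchanged. So `γ^𝒲(x)` acts as `ad x` on all generators. -/
theorem gammaW_mul_left {p i : ZMod 2} {x y : 𝔤} (hx : x ∈ par p) (hy : y ∈ par i) :
    b.gammaW x * Weil.left 𝔤 (Env.ι y) =
      sgn p i • (Weil.left 𝔤 (Env.ι y) * b.gammaW x) + Weil.left 𝔤 (Env.ι (bracket x y)) := by
  rw [gammaW_apply, add_mul, ← map_mul, Env.ι_mul_ι hx hy,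
    Weil.right_mul_left (Env.ι_mem hy) (Submodule.smul_mem _ _ (b.gamma_mem hx)), map_add,
    map_smul, map_mul, mul_add]
  module

theorem gammaW_mul_right {p i : ZMod 2} {x y : 𝔤} (hx : x ∈ par p) (hy : y ∈ par i) :
    b.gammaW x * Weil.right 𝔤 (Cl.ι y) =
      sgn p i • (Weil.right 𝔤 (Cl.ι y) * b.gammaW x) + Weil.right 𝔤 (Cl.ι (bracket x y)) := by
  rw [gammaW_apply, add_mul, ← map_mul, b.half_gamma_mul_ι hx hy, map_add, map_smul, map_mul,
    mul_add, Weil.right_mul_left (Env.ι_mem hx) (Cl.ι_mem hy), smul_add, smul_smul, sgn_comm i p,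
    sgn_mul_self, one_smul]
  abel

theorem dirac_eq : b.dirac =
    ∑ a, Weil.left 𝔤 (Env.ι (b.dual a)) * Weil.right 𝔤 (Cl.ι (b.e a)) +
      Weil.right 𝔤 b.phiPrime := by
  simp_rw [dirac, Weil.tmul_eq, map_one, one_mul]

theorem right_phiPrime_mul_left {i : ZMod 2} {x : 𝔤} (hx : x ∈ par i) :
    Weil.right 𝔤 b.phiPrime * Weil.left 𝔤 (Env.ι x) =
      Weil.left 𝔤 (Env.ι x) * Weil.right 𝔤 b.phiPrime := by
  rw [Weil.right_mul_left (Env.ι_mem hx) b.phiPrime_mem]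
  simp [sgn]

/-- Contraction of the linear part gives `2x ⊗ 1` and `φ'` gives `-γ'(x)`, which together are
`2γ^𝒲(x)`. -/
theorem dirac_mul_right (x : 𝔤) : b.dirac * Weil.right 𝔤 (Cl.ι x) =
    -(Weil.right 𝔤 (Cl.ι x) * b.dirac) + (2 : ℂ) • b.gammaW x := by
  induction x using par_induction with
  | hadd x y hx hy => simp only [map_add, mul_add, add_mul, hx, hy, smul_add]; abel
  | hpar p x hx =>
    have key : ∀ a, Weil.left 𝔤 (Env.ι (b.dual a)) * Weil.right 𝔤 (Cl.ι (b.e a)) *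
        Weil.right 𝔤 (Cl.ι x) = (2 : ℂ) • Weil.left 𝔤 (Env.ι (form (b.e a) x • b.dual a)) -
          Weil.right 𝔤 (Cl.ι x) *
            (Weil.left 𝔤 (Env.ι (b.dual a)) * Weil.right 𝔤 (Cl.ι (b.e a))) := by
      intro a
      rw [mul_assoc, ← map_mul, Cl.ι_mul_ι_eq (b.mem a) hx, ← mul_assoc,
        Weil.right_mul_left (Env.ι_mem (b.dual_mem a)) (Cl.ι_mem hx), map_sub, map_smul, map_one,
        map_smul, map_mul, mul_sub, mul_smul_comm, mul_one, mul_smul_comm, smul_mul_assoc,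
        mul_assoc, sgn_comm p, map_smul, map_smul]
      module
    rw [dirac_eq, add_mul, Finset.sum_mul, Finset.sum_congr rfl fun a _ => key a,
      Finset.sum_sub_distrib, ← Finset.smul_sum, ← map_sum, ← map_sum, b.sum_form_smul_dual,
      ← map_mul, phiPrime_mul_ι, gammaW_apply, ← Finset.mul_sum, map_sub, map_neg, map_mul,
      map_smul]
    rw [mul_add]
    module

theorem gammaW_mul_dirac (x : 𝔤) : b.gammaW x * b.dirac = b.dirac * b.gammaW x := by
  induction x using par_induction with
  | hadd x y hx hy => rw [map_add, mul_add, add_mul, hx, hy]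
  | hpar p x hx =>
    have key : ∀ a, b.gammaW x *
        (Weil.left 𝔤 (Env.ι (b.dual a)) * Weil.right 𝔤 (Cl.ι (b.e a))) =
        Weil.left 𝔤 (Env.ι (b.dual a)) * Weil.right 𝔤 (Cl.ι (b.e a)) * b.gammaW x +
        (sgn p (b.deg a) •
          (Weil.left 𝔤 (Env.ι (b.dual a)) * Weil.right 𝔤 (Cl.ι (bracket x (b.e a)))) +
        Weil.left 𝔤 (Env.ι (bracket x (b.dual a))) * Weil.right 𝔤 (Cl.ι (b.e a))) := by
      intro a
      rw [← mul_assoc, b.gammaW_mul_left hx (b.dual_mem a), add_mul, smul_mul_assoc, mul_assoc,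
        b.gammaW_mul_right hx (b.mem a), mul_add, mul_smul_comm, smul_add, smul_smul,
        sgn_mul_self, one_smul, mul_assoc]
      abel
    have inv := b.sum_bracket_left (bilinMul ((Weil.left 𝔤).toLinearMap ∘ₗ Env.ι)
      ((Weil.right 𝔤).toLinearMap ∘ₗ Cl.ι)) hx
    simp only [bilinMul_apply, LinearMap.comp_apply, AlgHom.toLinearMap_apply] at inv
    rw [dirac_eq, mul_add, add_mul, Finset.mul_sum, Finset.sum_congr rfl fun a _ => key a,
      Finset.sum_add_distrib, Finset.sum_add_distrib, inv, neg_add_cancel, add_zero,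
      b.mul_map_phiPrime (Weil.right 𝔤) hx (fun i y hy => b.gammaW_mul_right hx hy),
      Finset.sum_mul]

/-- With `P = ∑ eᵃ ⊗ eₐ` and `G = ∑ eᵃ ⊗ γ'(eₐ)` one has `P² = Ω + G` and `Pφ' + φ'P = -G`, so only
`Ω + φ'²` remains. -/
theorem dirac_sq : b.dirac ^ 2 = Weil.left 𝔤 b.casimir +
    algebraMap ℂ (Weil 𝔤) ((1 / 24) * b.strCasimir) := by
  set U : I → Weil 𝔤 := fun a => Weil.left 𝔤 (Env.ι (b.dual a)) with hU
  set c : I → Weil 𝔤 := fun a => Weil.right 𝔤 (Cl.ι (b.e a)) with hc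
  set G := ∑ a, U a * Weil.right 𝔤 (b.gamma (b.e a)) with hG
  have hcU : ∀ a a', c a * U a' = sgn (b.deg a) (b.deg a') • (U a' * c a) := fun a a' =>
    Weil.right_mul_left (Env.ι_mem (b.dual_mem a')) (Cl.ι_mem (b.mem a))
  have hP : (∑ a, U a * c a) * (∑ a, U a * c a) =
      ∑ a, ∑ d, sgn (b.deg a) (b.deg d) • (U a * U d * (c a * c d)) := by
    rw [Finset.sum_mul_sum]
    refine Finset.sum_congr rfl fun a _ => Finset.sum_congr rfl fun d _ => ?_
    rw [mul_assoc, ← mul_assoc (c a), hcU, smul_mul_assoc, mul_smul_comm]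
    simp only [mul_assoc]
  -- Exchanging the two indices in both tensor factors reproduces the term with opposite sign, a
  -- Clifford contraction (giving `Ω`) and a bracket in `𝔘(𝔤)` (giving `G`). Summation yields `P² =
  -- 2Ω - P² + 2G`.
  have hterm : ∀ a d, sgn (b.deg a) (b.deg d) • (U a * U d * (c a * c d)) =
      (2 : ℂ) • (U d * Weil.left 𝔤 (Env.ι (form (b.e a) (b.e d) • b.dual a))) -
      sgn (b.deg d) (b.deg a) • (U d * U a * (c d * c a)) -
      Weil.left 𝔤 (Env.ι (bracket (b.dual d) (b.dual a))) * c a * c d := by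
    intro a d
    have h1 : U a * U d = sgn (b.deg a) (b.deg d) • (U d * U a) +
        Weil.left 𝔤 (Env.ι (bracket (b.dual a) (b.dual d))) := by
      simp only [hU]
      rw [← map_mul, Env.ι_mul_ι (b.dual_mem a) (b.dual_mem d), map_add, map_smul, map_mul]
    have h2 : c a * c d = (2 * form (b.e a) (b.e d)) • 1 -
        sgn (b.deg a) (b.deg d) • (c d * c a) := by
      simp only [hc]
      rw [← map_mul, Cl.ι_mul_ι_eq (b.mem a) (b.mem d), map_sub, map_smul, map_smul, map_mul,
        map_one]
    rw [h1, add_mul, smul_mul_assoc, smul_add, smul_smul, sgn_mul_self, one_smul, h2, mul_sub,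
      mul_smul_comm, mul_smul_comm, mul_one, ← h2, bracket_skew (b.dual_mem a) (b.dual_mem d),
      sgn_comm (b.deg d)]
    simp only [map_neg, map_smul, neg_mul, smul_mul_assoc, smul_neg, smul_smul, sgn_mul_self,
      one_smul, mul_assoc, mul_smul_comm]
    rw [mul_smul]
    abel
  have hΩ : ∑ d, ∑ a, U d * Weil.left 𝔤 (Env.ι (form (b.e a) (b.e d) • b.dual a)) =
      Weil.left 𝔤 b.casimir := by
    simp_rw [← Finset.mul_sum, ← map_sum, b.sum_form_smul_dual, casimir, map_sum, map_mul, hU]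
  have hY : ∑ d, ∑ a, Weil.left 𝔤 (Env.ι (bracket (b.dual d) (b.dual a))) * c a * c d =
      (-2 : ℂ) • G := by
    have inv : ∀ d, ∑ a, Weil.left 𝔤 (Env.ι (bracket (b.dual d) (b.dual a))) * c a =
        ∑ a, U a * Weil.right 𝔤 (Cl.ι (bracket (b.e a) (b.dual d))) := fun d =>
      (b.sum_bracket_right (bilinMul ((Weil.left 𝔤).toLinearMap ∘ₗ Env.ι)
        ((Weil.right 𝔤).toLinearMap ∘ₗ Cl.ι)) (b.dual d)).symm
    simp_rw [← Finset.sum_mul, inv, Finset.sum_mul]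
    rw [Finset.sum_comm, hG, Finset.smul_sum]
    refine Finset.sum_congr rfl fun a _ => ?_
    simp_rw [mul_assoc, ← Finset.mul_sum, hc, ← map_mul, ← map_sum, b.sum_bracket_mul, map_smul,
      mul_smul_comm]
  have hPP : (∑ a, U a * c a) * (∑ a, U a * c a) = Weil.left 𝔤 b.casimir + G := by
    have h : (∑ a, U a * c a) * (∑ a, U a * c a) = (2 : ℂ) • Weil.left 𝔤 b.casimir -
        (∑ a, U a * c a) * (∑ a, U a * c a) - (-2 : ℂ) • G := by
      conv_lhs => rw [hP, Finset.sum_comm]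
      rw [Finset.sum_congr rfl fun d _ => Finset.sum_congr rfl fun a _ => hterm a d]
      simp only [Finset.sum_sub_distrib, ← Finset.smul_sum]
      rw [hΩ, hY, hP]
    generalize (∑ a, U a * c a) * (∑ a, U a * c a) = X at h ⊢
    have h3 : (2 : ℂ) • X = (2 : ℂ) • (Weil.left 𝔤 b.casimir + G) := by
      rw [two_smul]
      nth_rewrite 1 [h]
      module
    exact smul_right_injective _ (two_ne_zero : (2 : ℂ) ≠ 0) h3
  have hcross : Weil.right 𝔤 b.phiPrime * (∑ a, U a * c a) =
      -((∑ a, U a * c a) * Weil.right 𝔤 b.phiPrime) - G := by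
    rw [Finset.mul_sum, Finset.sum_mul, ← Finset.sum_neg_distrib, hG, ← Finset.sum_sub_distrib]
    refine Finset.sum_congr rfl fun a _ => ?_
    rw [← mul_assoc, b.right_phiPrime_mul_left (b.dual_mem a), mul_assoc, ← map_mul,
      b.phiPrime_mul_ι, map_sub, map_neg, map_mul, mul_sub, mul_neg, mul_assoc]
  have hφ : Weil.right 𝔤 b.phiPrime * Weil.right 𝔤 b.phiPrime =
      algebraMap ℂ (Weil 𝔤) ((1 / 24) * b.strCasimir) := by
    rw [← map_mul, ← sq, phiPrime_sq, map_smul, map_one, Algebra.algebraMap_eq_smul_one]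
  rw [dirac_eq, sq, add_mul, mul_add, mul_add, hPP, hcross, hφ]
  abel

end HomogeneousBasis
end CubicDirac

/-! ### The canonical map -/

section Generators

/-- Supercommutation with `w` becomes intertwining once the sign is put into an automorphism inside
`g`, so it can be checked on generators. -/
theorem adjoin_intertwine {A B : Type*} [Ring A] [Algebra ℂ A] [Ring B] [Algebra ℂ B]
    {f g : B →ₐ[ℂ] A} {w : A} {S : Set B} (hS : ∀ x ∈ S, w * f x = g x * w) {x : B}
    (hx : x ∈ Algebra.adjoin ℂ S) : w * f x = g x * w := by
  induction hx using Algebra.adjoin_induction with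
  | mem x hx => exact hS x hx
  | algebraMap r => rw [AlgHom.commutes, AlgHom.commutes, Algebra.commutes]
  | add x y _ _ hx hy => rw [map_add, map_add, mul_add, add_mul, hx, hy]
  | mul x y _ _ hx hy => rw [map_mul, map_mul, ← mul_assoc, hx, mul_assoc, hy, mul_assoc]

variable {𝔤 : Type*} [AddCommGroup 𝔤] [Module ℂ 𝔤]

theorem Env.adjoin_range_ι [LieSuperalgebra 𝔤] :
    Algebra.adjoin ℂ (Set.range (Env.ι : 𝔤 →ₗ[ℂ] Env 𝔤)) = ⊤ := by
  set S := Algebra.adjoin ℂ (Set.range (Env.ι : 𝔤 →ₗ[ℂ] Env 𝔤))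
  let g : 𝔤 →ₗ[ℂ] S := Env.ι.codRestrict (Subalgebra.toSubmodule S)
    fun x => Algebra.subset_adjoin ⟨x, rfl⟩
  let F : Env 𝔤 →ₐ[ℂ] S := Env.lift g fun i j x y hx hy => Subtype.ext (Env.ι_mul_ι hx hy)
  have hF : S.val.comp F = AlgHom.id ℂ _ := Env.hom_ext fun x =>
    congrArg Subtype.val (Env.lift_ι g _ x)
  refine eq_top_iff.2 fun x _ => ?_
  have hx : F x = x := AlgHom.congr_fun hF x
  exact hx ▸ (F x).2

theorem Env.twist_apply [LieSuperalgebra 𝔤] (p : ZMod 2) {i : ZMod 2} {u : Env 𝔤}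
    (hu : u ∈ Env.grading 𝔤 i) : Env.twist p u = sgn p i • u := by
  rcases zmod2_cases p with rfl | rfl
  · simp [Env.twist, sgn]
  · simpa [Env.twist] using mem_eig.1 hu

variable [QuadraticLieSuperalgebra 𝔤]

theorem Cl.adjoin_range_ι : Algebra.adjoin ℂ (Set.range (Cl.ι : 𝔤 →ₗ[ℂ] Cl 𝔤)) = ⊤ := by
  set S := Algebra.adjoin ℂ (Set.range (Cl.ι : 𝔤 →ₗ[ℂ] Cl 𝔤))
  let g : 𝔤 →ₗ[ℂ] S := Cl.ι.codRestrict (Subalgebra.toSubmodule S)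
    fun x => Algebra.subset_adjoin ⟨x, rfl⟩
  let F : Cl 𝔤 →ₐ[ℂ] S := Cl.lift g fun i j x y hx hy => Subtype.ext (Cl.ι_mul_ι hx hy)
  have hF : S.val.comp F = AlgHom.id ℂ _ := Cl.hom_ext fun x =>
    congrArg Subtype.val (Cl.lift_ι g _ x)
  refine eq_top_iff.2 fun x _ => ?_
  have hx : F x = x := AlgHom.congr_fun hF x
  exact hx ▸ (F x).2

/-- `c ↦ (-1)^(p * p(c)) c` on `Cl(𝔤)`. -/
noncomputable def Cl.twist (p : ZMod 2) : Cl 𝔤 →ₐ[ℂ] Cl 𝔤 :=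
  if p = 1 then Cl.parity else AlgHom.id ℂ _

theorem Cl.twist_apply (p : ZMod 2) {i : ZMod 2} {c : Cl 𝔤} (hc : c ∈ Cl.grading 𝔤 i) :
    Cl.twist p c = sgn p i • c := by
  rcases zmod2_cases p with rfl | rfl
  · simp [Cl.twist, sgn]
  · simpa [Cl.twist] using mem_eig.1 hc

end Generators

/-! ### Existence and uniqueness of `j`, and its interaction with the Dirac operators. -/

section Canonical

variable {𝔤 : Type*} [AddCommGroup 𝔤] [Module ℂ 𝔤] [QuadraticLieSuperalgebra 𝔤]

theorem HomogeneousBasis.gammaW_mul_gammaW {I : Type*} [Fintype I] (b : HomogeneousBasis 𝔤 I)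
    {p i : ZMod 2} {x y : 𝔤} (hx : x ∈ par p) (hy : y ∈ par i) :
    b.gammaW x * b.gammaW y = sgn p i • (b.gammaW y * b.gammaW x) + b.gammaW (bracket x y) := by
  have h := b.mul_map_gamma (Weil.right 𝔤) hx (fun i y hy => b.gammaW_mul_right hx hy) hy
  rw [b.gammaW_apply y, mul_add, b.gammaW_mul_left hx hy, map_smul, mul_smul_comm, h,
    b.gammaW_apply (bracket x y), map_smul, add_mul, smul_mul_assoc]
  module

namespace QuadraticSubalgebra

variable (𝔩 : QuadraticSubalgebra 𝔤)

/-- The inclusion `Cl(𝔩) → Cl(𝔤)`. -/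
noncomputable def clMap : Cl 𝔩.toSubmodule →ₐ[ℂ] Cl 𝔤 :=
  Cl.lift (Cl.ι ∘ₗ 𝔩.toSubmodule.subtype) fun _ _ _ _ hx hy => Cl.ι_mul_ι (𝔤 := 𝔤) hx hy

@[simp]
theorem clMap_ι (x : 𝔩.toSubmodule) : 𝔩.clMap (Cl.ι x) = Cl.ι (x : 𝔤) := Cl.lift_ι _ _ x

/-- The composite `Cl(𝔩) → Cl(𝔤) → 𝒲(𝔤)`. -/
noncomputable def clHom : Cl 𝔩.toSubmodule →ₐ[ℂ] Weil 𝔤 := (Weil.right 𝔤).comp 𝔩.clMap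

theorem clHom_ι (x : 𝔩.toSubmodule) : 𝔩.clHom (Cl.ι x) = Weil.right 𝔤 (Cl.ι (x : 𝔤)) := by
  rw [clHom, AlgHom.comp_apply, clMap_ι]

variable {I J : Type*} [Fintype I] [Fintype J] (e : HomogeneousBasis 𝔤 I)
  (f : HomogeneousBasis 𝔩.toSubmodule J)

theorem gammaW_mul_clHom_ι {p i : ZMod 2} {x y : 𝔩.toSubmodule} (hx : x ∈ par p)
    (hy : y ∈ par i) : e.gammaW (x : 𝔤) * 𝔩.clHom (Cl.ι y) =
      sgn p i • (𝔩.clHom (Cl.ι y) * e.gammaW (x : 𝔤)) + 𝔩.clHom (Cl.ι (bracket x y)) := by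
  simp only [clHom_ι]
  exact e.gammaW_mul_right (𝔤 := 𝔤) hx hy

/-- The image of `x ⊗ 1` under the canonical map. -/
noncomputable def envGen : 𝔩.toSubmodule →ₗ[ℂ] Weil 𝔤 :=
  e.gammaW ∘ₗ 𝔩.toSubmodule.subtype + (1 / 2 : ℂ) • 𝔩.clHom.toLinearMap ∘ₗ f.gamma

theorem envGen_apply (x : 𝔩.toSubmodule) :
    𝔩.envGen e f x = e.gammaW (x : 𝔤) + (1 / 2 : ℂ) • 𝔩.clHom (f.gamma x) := rfl

/-- Put `ρ = γ^𝒲` and `σ = -1/2 γ'_𝔩`. The superbrackets `[ρx,ρy] = ρ[x,y]` and `[ρx,σy] = [σx,ρy] =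
[σx,σy] = σ[x,y]` make `ρ - σ` a representation. -/
theorem envGen_rel (i j : ZMod 2) (x y : 𝔩.toSubmodule) (hx : x ∈ par i) (hy : y ∈ par j) :
    𝔩.envGen e f x * 𝔩.envGen e f y =
      sgn i j • (𝔩.envGen e f y * 𝔩.envGen e f x) + 𝔩.envGen e f (bracket x y) := by
  have h1 : e.gammaW (x : 𝔤) * e.gammaW (y : 𝔤) =
      sgn i j • (e.gammaW (y : 𝔤) * e.gammaW (x : 𝔤)) +
        e.gammaW ((bracket x y : 𝔩.toSubmodule) : 𝔤) :=
    e.gammaW_mul_gammaW (𝔤 := 𝔤) hx hy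
  have h2 := f.mul_map_gamma 𝔩.clHom hx (fun k z hz => 𝔩.gammaW_mul_clHom_ι e hx hz) hy
  have h3 := f.mul_map_gamma 𝔩.clHom hy (fun k z hz => 𝔩.gammaW_mul_clHom_ι e hy hz) hx
  have h4 := congrArg 𝔩.clHom (f.gamma_mul_gamma hx hy)
  rw [map_mul, map_sub, map_smul, map_smul, map_mul] at h4
  rw [bracket_skew hy hx, map_neg, map_smul, map_neg, map_smul, sgn_comm j i] at h3
  have h5 : 𝔩.clHom (f.gamma x) * e.gammaW (y : 𝔤) =
      sgn i j • (e.gammaW (y : 𝔤) * 𝔩.clHom (f.gamma x)) + 𝔩.clHom (f.gamma (bracket x y)) := by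
    rw [h3, smul_add, smul_neg, smul_smul, smul_smul, sgn_mul_self, one_smul, one_smul]
    abel
  simp only [envGen_apply, mul_add, add_mul, mul_smul_comm, smul_mul_assoc, h1, h2, h4, h5]
  module

/-- `γ^𝒲(x)` and `-1/2 γ'_𝔩(x)` both act on `Cl(𝔩)` as `ad x`, so their difference supercommutes
with it. This is the compatibility needed to define `j` on the graded tensor product. -/
theorem envGen_mul_clHom {p i : ZMod 2} {x : 𝔩.toSubmodule} {c : Cl 𝔩.toSubmodule}
    (hx : x ∈ par p) (hc : c ∈ Cl.grading 𝔩.toSubmodule i) :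
    𝔩.envGen e f x * 𝔩.clHom c = sgn p i • (𝔩.clHom c * 𝔩.envGen e f x) := by
  have h : 𝔩.envGen e f x * 𝔩.clHom c = 𝔩.clHom.comp (Cl.twist p) c * 𝔩.envGen e f x := by
    refine adjoin_intertwine (S := Set.range (Cl.ι (𝔤 := 𝔩.toSubmodule))) ?_
      (by rw [Cl.adjoin_range_ι]; exact Algebra.mem_top)
    rintro _ ⟨y, rfl⟩
    induction y using par_induction with
    | hadd y z hy hz => rw [map_add, map_add, map_add, mul_add, add_mul, hy, hz]
    | hpar j y hy =>
      have h := congrArg 𝔩.clHom (f.gamma_mul_ι hx hy)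
      rw [map_mul, map_sub, map_smul, map_smul, map_mul] at h
      rw [envGen_apply, add_mul, 𝔩.gammaW_mul_clHom_ι e hx hy, smul_mul_assoc, h,
        AlgHom.comp_apply, Cl.twist_apply p (Cl.ι_mem hy), map_smul, smul_mul_assoc, mul_add,
        mul_smul_comm]
      module
  rw [h, AlgHom.comp_apply, Cl.twist_apply p hc, map_smul, smul_mul_assoc]

/-- The restriction of the canonical map to `𝔘(𝔩)`. -/
noncomputable def envHom : Env 𝔩.toSubmodule →ₐ[ℂ] Weil 𝔤 :=
  Env.lift (𝔩.envGen e f) (𝔩.envGen_rel e f)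

theorem envHom_mul_clHom {i j : ZMod 2} {u : Env 𝔩.toSubmodule} {c : Cl 𝔩.toSubmodule}
    (hu : u ∈ Env.grading 𝔩.toSubmodule i) (hc : c ∈ Cl.grading 𝔩.toSubmodule j) :
    𝔩.envHom e f u * 𝔩.clHom c = sgn j i • (𝔩.clHom c * 𝔩.envHom e f u) := by
  have h : 𝔩.clHom c * 𝔩.envHom e f u =
      (𝔩.envHom e f).comp (Env.twist j) u * 𝔩.clHom c := by
    refine adjoin_intertwine (S := Set.range (Env.ι (𝔤 := 𝔩.toSubmodule))) ?_
      (by rw [Env.adjoin_range_ι]; exact Algebra.mem_top)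
    rintro _ ⟨y, rfl⟩
    induction y using par_induction with
    | hadd y z hy hz => rw [map_add, map_add, map_add, mul_add, add_mul, hy, hz]
    | hpar k y hy =>
      rw [AlgHom.comp_apply, Env.twist_apply j (Env.ι_mem hy), map_smul, envHom, Env.lift_ι,
        smul_mul_assoc, 𝔩.envGen_mul_clHom e f hy hc, smul_smul, sgn_comm k, sgn_mul_self,
        one_smul]
  rw [h, AlgHom.comp_apply, Env.twist_apply j hu, map_smul, smul_mul_assoc, smul_smul,
    sgn_mul_self, one_smul]

/-- The canonical map `𝒲(𝔩) → 𝒲(𝔤)`. -/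
noncomputable def canonicalMap : Weil 𝔩.toSubmodule →ₐ[ℂ] Weil 𝔤 :=
  GradedTensorProduct.lift (Env.grading 𝔩.toSubmodule) (Cl.grading 𝔩.toSubmodule)
    (𝔩.envHom e f) 𝔩.clHom fun i j u c => by
      rw [units_pow_smul]
      exact 𝔩.envHom_mul_clHom e f u.2 c.2

theorem canonicalMap_right (c : Cl 𝔩.toSubmodule) :
    𝔩.canonicalMap e f (Weil.right _ c) = 𝔩.clHom c :=
  (GradedTensorProduct.lift_tmul _ _ _ _ _ 1 c).trans (by rw [map_one, one_mul])

theorem canonicalMap_left_ι (x : 𝔩.toSubmodule) :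
    𝔩.canonicalMap e f (Weil.left _ (Env.ι x)) = 𝔩.envGen e f x :=
  (GradedTensorProduct.lift_tmul _ _ _ _ _ (Env.ι x) 1).trans
    (by rw [map_one, mul_one, envHom, Env.lift_ι])

theorem isCanonicalMap_canonicalMap : 𝔩.IsCanonicalMap e f (𝔩.canonicalMap e f) := by
  refine ⟨fun x => ?_, fun p x hx => ?_⟩
  · rw [Weil.one_tmul, canonicalMap_right, clHom_ι, Weil.one_tmul]
  · rw [f.gammaWeil_eq hx, e.gammaWeil_eq (x := (x : 𝔤)) hx, f.gammaW_apply, map_add,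
      canonicalMap_right, canonicalMap_left_ι, envGen_apply, map_smul]
    module

variable {𝔩 e f} {j : Weil 𝔩.toSubmodule →ₐ[ℂ] Weil 𝔤}

theorem IsCanonicalMap.right_ι (hj : 𝔩.IsCanonicalMap e f j) (x : 𝔩.toSubmodule) :
    j (Weil.right _ (Cl.ι x)) = Weil.right 𝔤 (Cl.ι (x : 𝔤)) := hj.1 x

theorem IsCanonicalMap.right (hj : 𝔩.IsCanonicalMap e f j) (c : Cl 𝔩.toSubmodule) :
    j (Weil.right _ c) = Weil.right 𝔤 (𝔩.clMap c) :=
  AlgHom.congr_fun (Cl.hom_ext (f := j.comp (Weil.right _)) (g := (Weil.right 𝔤).comp 𝔩.clMap)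
    fun x => by simpa using hj.right_ι x) c

theorem IsCanonicalMap.gammaW (hj : 𝔩.IsCanonicalMap e f j) (x : 𝔩.toSubmodule) :
    j (f.gammaW x) = e.gammaW (x : 𝔤) := by
  induction x using par_induction with
  | hadd x y hx hy => rw [map_add, map_add, hx, hy, Submodule.coe_add, map_add]
  | hpar p x hx =>
    rw [← f.gammaWeil_eq hx, hj.2 p x hx, e.gammaWeil_eq (x := (x : 𝔤)) hx]

theorem IsCanonicalMap.left_ι (hj : 𝔩.IsCanonicalMap e f j) (x : 𝔩.toSubmodule) :
    j (Weil.left _ (Env.ι x)) =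
      e.gammaW (x : 𝔤) + (1 / 2 : ℂ) • Weil.right 𝔤 (𝔩.clMap (f.gamma x)) := by
  have h := hj.gammaW x
  rw [f.gammaW_apply, map_add, map_smul, map_smul, hj.right] at h
  rw [← h]
  module

/-- As `γ'_𝔩(x)` lies in `Cl(𝔩)`, the two conditions fix the images of `1 ⊗ x` and of `x ⊗ 1`, which
generate `𝒲(𝔩)`. -/
theorem IsCanonicalMap.unique {j' : Weil 𝔩.toSubmodule →ₐ[ℂ] Weil 𝔤}
    (hj : 𝔩.IsCanonicalMap e f j) (hj' : 𝔩.IsCanonicalMap e f j') : j' = j := by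
  refine GradedTensorProduct.algHom_ext _ _ (Env.hom_ext fun x => ?_) (Cl.hom_ext fun x => ?_)
  · exact (hj'.left_ι x).trans (hj.left_ι x).symm
  · exact (hj'.right_ι x).trans (hj.right_ι x).symm

/-! ### The square of the relative Dirac operator -/

/-- The defects of `D_𝔤` and of `j(D_𝔩)` are `2γ^{𝒲(𝔤)}(x)` and `2j(γ^{𝒲(𝔩)}(x))`, which agree and
cancel. -/
theorem IsCanonicalMap.relDirac_mul_right (hj : 𝔩.IsCanonicalMap e f j) (x : 𝔩.toSubmodule) :
    relDirac e f j * Weil.right 𝔤 (Cl.ι (x : 𝔤)) =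
      -(Weil.right 𝔤 (Cl.ι (x : 𝔤)) * relDirac e f j) := by
  have h := congrArg j (f.dirac_mul_right x)
  rw [map_mul, map_add, map_neg, map_mul, map_smul, hj.right_ι, hj.gammaW] at h
  rw [relDirac, sub_mul, mul_sub, h, e.dirac_mul_right]
  abel

theorem IsCanonicalMap.gammaW_mul_relDirac (hj : 𝔩.IsCanonicalMap e f j) (x : 𝔩.toSubmodule) :
    e.gammaW (x : 𝔤) * relDirac e f j = relDirac e f j * e.gammaW (x : 𝔤) := by
  have h := congrArg j (f.gammaW_mul_dirac x)
  rw [map_mul, map_mul, hj.gammaW] at h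
  rw [relDirac, sub_mul, mul_sub, h, e.gammaW_mul_dirac]

theorem IsCanonicalMap.relDirac_mul_gamma (hj : 𝔩.IsCanonicalMap e f j) (x : 𝔩.toSubmodule) :
    relDirac e f j * Weil.right 𝔤 (𝔩.clMap (f.gamma x)) =
      Weil.right 𝔤 (𝔩.clMap (f.gamma x)) * relDirac e f j := by
  simp only [f.gamma_apply, map_smul, map_sum, map_mul, clMap_ι, mul_smul_comm, smul_mul_assoc,
    Finset.mul_sum, Finset.sum_mul]
  congr 1
  refine Finset.sum_congr rfl fun a _ => ?_
  rw [← mul_assoc, hj.relDirac_mul_right, neg_mul, mul_assoc, hj.relDirac_mul_right, mul_neg,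
    neg_neg, mul_assoc]

/-- `D_{𝔤,𝔩}` commutes with `j(x ⊗ 1)` and anticommutes with each Clifford generator from `𝔩`, and
every term of `D_𝔩` contains an odd number of the latter. -/
theorem IsCanonicalMap.relDirac_mul_map_dirac (hj : 𝔩.IsCanonicalMap e f j) :
    relDirac e f j * j f.dirac = -(j f.dirac * relDirac e f j) := by
  have h1 : ∀ a, relDirac e f j * j (Weil.left _ (Env.ι (f.dual a)) * Weil.right _ (Cl.ι (f.e a))) =
      -(j (Weil.left _ (Env.ι (f.dual a)) * Weil.right _ (Cl.ι (f.e a))) * relDirac e f j) := by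
    intro a
    have h : relDirac e f j * j (Weil.left _ (Env.ι (f.dual a))) =
        j (Weil.left _ (Env.ι (f.dual a))) * relDirac e f j := by
      rw [hj.left_ι, mul_add, add_mul, ← hj.gammaW_mul_relDirac, mul_smul_comm,
        hj.relDirac_mul_gamma, smul_mul_assoc]
    rw [map_mul, hj.right_ι, ← mul_assoc, h, mul_assoc, hj.relDirac_mul_right, mul_neg, mul_assoc]
  have h2 : relDirac e f j * Weil.right 𝔤 (𝔩.clMap f.phiPrime) =
      -(Weil.right 𝔤 (𝔩.clMap f.phiPrime) * relDirac e f j) := by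
    rw [f.phiPrime_eq]
    simp only [map_smul, map_sum, map_mul, clMap_ι, mul_smul_comm, smul_mul_assoc,
      Finset.mul_sum, Finset.sum_mul]
    rw [← smul_neg, ← Finset.sum_neg_distrib]
    congr 1
    refine Finset.sum_congr rfl fun a _ => ?_
    rw [← mul_assoc, hj.relDirac_mul_right, neg_mul, mul_assoc, hj.relDirac_mul_gamma, mul_assoc]
  rw [f.dirac_eq, map_add, map_sum, hj.right, mul_add, add_mul, h2, Finset.mul_sum,
    Finset.sum_mul, Finset.sum_congr rfl fun a _ => h1 a, Finset.sum_neg_distrib, neg_add]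

theorem IsCanonicalMap.relDirac_sq (hj : 𝔩.IsCanonicalMap e f j) :
    relDirac e f j ^ 2 = Weil.tmul e.casimir 1 - j (Weil.tmul f.casimir 1) +
      algebraMap ℂ (Weil 𝔤) ((1 / 24) * e.strCasimir) -
      algebraMap ℂ (Weil 𝔤) ((1 / 24) * f.strCasimir) := by
  have h1 : e.dirac = relDirac e f j + j f.dirac := by rw [relDirac, sub_add_cancel]
  have h2 : e.dirac ^ 2 = relDirac e f j ^ 2 + j (f.dirac ^ 2) := by
    rw [h1, sq, add_mul, mul_add, mul_add, hj.relDirac_mul_map_dirac, map_pow, sq, sq]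
    abel
  rw [e.dirac_sq, f.dirac_sq, map_add, AlgHom.commutes, ← sub_eq_iff_eq_add] at h2
  rw [← h2, Weil.tmul_one, Weil.tmul_one]
  abel

end QuadraticSubalgebra
end Canonical

/-! ### Lie derivatives and contractions as commutators -/

section Commutators

/-- A triangular homomorphism whose derivation part is inner on generators is inner. -/
theorem upperRight_eq_of_adjoin {A : Type*} [Ring A] [Algebra ℂ A]
    {Φ : A →ₐ[ℂ] Matrix (Fin 2) (Fin 2) A} {σ : A →ₐ[ℂ] A} {w : A} {S : Set A}
    (hS : ∀ x ∈ S, Φ x = !![σ x, w * x - σ x * w; 0, x]) {x : A}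
    (hx : x ∈ Algebra.adjoin ℂ S) : upperRight Φ x = w * x - σ x * w := by
  suffices h : Φ x = !![σ x, w * x - σ x * w; 0, x] from congrFun (congrFun h 0) 1
  induction hx using Algebra.adjoin_induction with
  | mem x hx => exact hS x hx
  | algebraMap r =>
    ext i j
    fin_cases i <;> fin_cases j <;> simp [Matrix.algebraMap_matrix_apply, Algebra.commutes]
  | add x y _ _ hx hy =>
    rw [map_add, hx, hy]
    ext i j
    fin_cases i <;> fin_cases j <;> simp [mul_add, add_mul]
    abel
  | mul x y _ _ hx hy =>
    rw [map_mul, hx, hy]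
    ext i j
    fin_cases i <;> fin_cases j <;> simp [mul_sub, sub_mul, mul_assoc]

variable {𝔤 : Type*} [AddCommGroup 𝔤] [Module ℂ 𝔤]

theorem Env.twist_ι [LieSuperalgebra 𝔤] (p : ZMod 2) (y : 𝔤) :
    Env.twist p (Env.ι y) = Env.ι (SuperWeil.twist 𝔤 p y) := by
  induction y using par_induction with
  | hadd y z hy hz => rw [map_add, map_add, hy, hz, map_add, map_add]
  | hpar i y hy =>
    rw [Env.twist_apply p (Env.ι_mem hy), SuperWeil.twist_apply p hy, map_smul]

/-- A superderivation is determined on generators, where this one is the superbracket with `x`.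
Using `twist` for the sign removes any homogeneity assumption on `u`. -/
theorem Env.lieDer_eq [LieSuperalgebra 𝔤] {p : ZMod 2} (x : par (𝔤 := 𝔤) p) (u : Env 𝔤) :
    Env.lieDer x u = Env.ι (x : 𝔤) * u - Env.twist p u * Env.ι (x : 𝔤) := by
  refine upperRight_eq_of_adjoin (S := Set.range Env.ι) ?_
    (by rw [Env.adjoin_range_ι]; exact Algebra.mem_top)
  rintro _ ⟨y, rfl⟩
  have h : Env.ι (bracket (x : 𝔤) y) =
      Env.ι (x : 𝔤) * Env.ι y - Env.twist p (Env.ι y) * Env.ι (x : 𝔤) := by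
    induction y using par_induction with
    | hadd y z hy hz => simp only [map_add, hy, hz, mul_add, add_mul]; abel
    | hpar i y hy =>
      rw [Env.twist_apply p (Env.ι_mem hy), Env.ι_mul_ι x.2 hy, smul_mul_assoc]
      abel
  rw [Env.lift_ι, ← h, Env.twist_ι]
  rfl

variable [QuadraticLieSuperalgebra 𝔤]

theorem Cl.twist_ι (p : ZMod 2) (y : 𝔤) :
    Cl.twist p (Cl.ι y) = Cl.ι (SuperWeil.twist 𝔤 p y) := by
  induction y using par_induction with
  | hadd y z hy hz => rw [map_add, map_add, hy, hz, map_add, map_add]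
  | hpar i y hy =>
    rw [Cl.twist_apply p (Cl.ι_mem hy), SuperWeil.twist_apply p hy, map_smul]

variable (𝔤) in
/-- The automorphism of `Cl(𝔤)` with `y ↦ -y` on `𝔤`, the parity of the word length. -/
noncomputable def Cl.alt : Cl 𝔤 →ₐ[ℂ] Cl 𝔤 :=
  Cl.lift (-Cl.ι) fun i j x y hx hy => by
    simpa using Cl.ι_mul_ι hx hy

@[simp]
theorem Cl.alt_ι (x : 𝔤) : Cl.alt 𝔤 (Cl.ι x) = -Cl.ι x := Cl.lift_ι _ _ x

/-- The contraction is inner as well, with signs from both gradings: `alt` supplies `(-1)^(i-1)` and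
`twist` the parity sign. The `1/2` offsets the `2` in the Clifford relation. -/
theorem Cl.contraction_eq {p : ZMod 2} (x : par (𝔤 := 𝔤) p) (c : Cl 𝔤) :
    Cl.contraction x c = ((1 / 2 : ℂ) • Cl.ι (x : 𝔤)) * c -
      (Cl.alt 𝔤).comp (Cl.twist p) c * ((1 / 2 : ℂ) • Cl.ι (x : 𝔤)) := by
  refine upperRight_eq_of_adjoin (S := Set.range Cl.ι) ?_
    (by rw [Cl.adjoin_range_ι]; exact Algebra.mem_top)
  rintro _ ⟨y, rfl⟩
  have h : algebraMap ℂ (Cl 𝔤) (form (x : 𝔤) y) = ((1 / 2 : ℂ) • Cl.ι (x : 𝔤)) * Cl.ι y -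
      (Cl.alt 𝔤).comp (Cl.twist p) (Cl.ι y) * ((1 / 2 : ℂ) • Cl.ι (x : 𝔤)) := by
    induction y using par_induction with
    | hadd y z hy hz => simp only [map_add, hy, hz, mul_add, add_mul]; abel
    | hpar i y hy =>
      rw [AlgHom.comp_apply, Cl.twist_apply p (Cl.ι_mem hy), map_smul, Cl.alt_ι, smul_mul_assoc,
        Cl.ι_mul_ι_eq x.2 hy, Algebra.algebraMap_eq_smul_one, smul_mul_smul_comm, neg_mul]
      module
  rw [Cl.lift_ι, ← h, AlgHom.comp_apply, Cl.twist_ι, Cl.alt_ι]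
  rfl

theorem Cl.contraction_ι {p : ZMod 2} (x : par (𝔤 := 𝔤) p) (y : 𝔤) :
    Cl.contraction x (Cl.ι y) = form (x : 𝔤) y • 1 := by
  rw [← Algebra.algebraMap_eq_smul_one]
  unfold Cl.contraction
  change Cl.lift (A := Matrix (Fin 2) (Fin 2) (Cl 𝔤)) _ _ (Cl.ι y) 0 1 = _
  rw [Cl.lift_ι]
  rfl

theorem Cl.contraction_ι_mul {p : ZMod 2} (x : par (𝔤 := 𝔤) p) (y : 𝔤) (c : Cl 𝔤) :
    Cl.contraction x (Cl.ι y * c) = form (x : 𝔤) y • c -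
      Cl.ι (SuperWeil.twist 𝔤 p y) * Cl.contraction x c := by
  have h1 := Cl.contraction_ι x y
  rw [← smul_one_mul (form (x : 𝔤) y) c, ← h1, Cl.contraction_eq, Cl.contraction_eq,
    Cl.contraction_eq, map_mul]
  rw [AlgHom.comp_apply _ _ (Cl.ι y), Cl.twist_ι, Cl.alt_ι]
  simp only [sub_mul, mul_sub, smul_mul_assoc, mul_smul_comm, neg_mul, mul_assoc]
  module

namespace HomogeneousBasis

variable {I : Type*} [Fintype I] (b : HomogeneousBasis 𝔤 I)

theorem lieDer_eq {p : ZMod 2} (x : par (𝔤 := 𝔤) p) (c : Cl 𝔤) :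
    Cl.lieDer x c = ((-(1 / 2) : ℂ) • b.gamma (x : 𝔤)) * c -
      Cl.twist p c * ((-(1 / 2) : ℂ) • b.gamma (x : 𝔤)) := by
  refine upperRight_eq_of_adjoin (S := Set.range Cl.ι) ?_
    (by rw [Cl.adjoin_range_ι]; exact Algebra.mem_top)
  rintro _ ⟨y, rfl⟩
  have h : Cl.ι (bracket (x : 𝔤) y) = ((-(1 / 2) : ℂ) • b.gamma (x : 𝔤)) * Cl.ι y -
      Cl.twist p (Cl.ι y) * ((-(1 / 2) : ℂ) • b.gamma (x : 𝔤)) := by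
    induction y using par_induction with
    | hadd y z hy hz => simp only [map_add, hy, hz, mul_add, add_mul]; abel
    | hpar i y hy =>
      rw [Cl.twist_apply p (Cl.ι_mem hy), b.half_gamma_mul_ι x.2 hy, smul_mul_assoc]
      abel
  rw [Cl.lift_ι, ← h, Cl.twist_ι]
  rfl

theorem alt_gamma (x : 𝔤) : Cl.alt 𝔤 (b.gamma x) = b.gamma x := by
  simp [gamma_apply]

theorem alt_phiPrime : Cl.alt 𝔤 b.phiPrime = -b.phiPrime := by
  simp [phiPrime_eq, alt_gamma]

end HomogeneousBasis

theorem Weil.map_tmul (S : Env 𝔤 →ₗ[ℂ] Env 𝔤) (T : Cl 𝔤 →ₗ[ℂ] Cl 𝔤) (u : Env 𝔤) (c : Cl 𝔤) :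
    Weil.map S T (Weil.tmul u c) = Weil.tmul (S u) (T c) := rfl

variable (𝔤) in
/-- The span of the `u ⊗ c` with `u` and `c` of equal parity and `c` of odd length. -/
noncomputable def Weil.oddPart : Submodule ℂ (Weil 𝔤) :=
  Submodule.span ℂ {w | ∃ i, ∃ u ∈ Env.grading 𝔤 i, ∃ c ∈ Cl.grading 𝔤 i,
    Cl.alt 𝔤 c = -c ∧ w = Weil.tmul u c}

theorem Weil.tmul_mem_oddPart {i : ZMod 2} {u : Env 𝔤} {c : Cl 𝔤} (hu : u ∈ Env.grading 𝔤 i)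
    (hc : c ∈ Cl.grading 𝔤 i) (h : Cl.alt 𝔤 c = -c) : Weil.tmul u c ∈ Weil.oddPart 𝔤 :=
  Submodule.subset_span ⟨i, u, hu, c, hc, h, rfl⟩

theorem Weil.right_mem_oddPart {c : Cl 𝔤} (hc : c ∈ Cl.grading 𝔤 0) (h : Cl.alt 𝔤 c = -c) :
    Weil.right 𝔤 c ∈ Weil.oddPart 𝔤 :=
  Weil.tmul_mem_oddPart SetLike.GradedOne.one_mem hc h

/-- Elements of `oddPart` have even total parity, so the supercommutator with `γ^𝒲(x)` is an
ordinary commutator. -/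
theorem Weil.lieDer_eq {I : Type*} [Fintype I] (b : HomogeneousBasis 𝔤 I) {p : ZMod 2}
    (x : par (𝔤 := 𝔤) p) {w : Weil 𝔤} (hw : w ∈ Weil.oddPart 𝔤) :
    Weil.lieDer x w = b.gammaW (x : 𝔤) * w - w * b.gammaW (x : 𝔤) := by
  induction hw using Submodule.span_induction with
  | zero => simp
  | add w w' _ _ hw hw' => rw [map_add, hw, hw', mul_add, add_mul]; abel
  | smul r w _ hw => rw [map_smul, hw, mul_smul_comm, smul_mul_assoc, smul_sub]
  | mem w hw =>
    obtain ⟨i, u, hu, c, hc, -, rfl⟩ := hw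
    have hg := Submodule.smul_mem _ (-(1 / 2) : ℂ) (b.gamma_mem x.2)
    rw [b.gammaW_apply]
    have hL := b.lieDer_eq x c
    set g := (-(1 / 2) : ℂ) • b.gamma (x : 𝔤)
    rw [Weil.lieDer, LinearMap.add_apply, Weil.map_tmul, Weil.map_tmul, AlgHom.toLinearMap_apply,
      LinearMap.id_apply, hL, Env.lieDer_eq, Env.twist_apply p hu, Cl.twist_apply p hc]
    have h1 := Weil.right_mul_left hu hg
    have h2 := Weil.right_mul_left (Env.ι_mem x.2) hc
    simp only [Weil.tmul_eq, map_sub, map_mul, map_smul, mul_add, add_mul, mul_sub, sub_mul,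
      smul_mul_assoc, mul_smul_comm, smul_smul, sgn_mul_self]
    rw [← mul_assoc (Weil.right 𝔤 g), h1, mul_assoc _ _ (Weil.left 𝔤 (Env.ι (x : 𝔤))), h2,
      sgn_comm i p]
    simp only [mul_assoc, smul_mul_assoc, mul_smul_comm, one_smul]
    abel

/-- Odd word length turns the twisted commutator of `contraction_eq` into an anticommutator, and
even total parity cancels the remaining signs. -/
theorem Weil.two_smul_contraction {p : ZMod 2} (x : par (𝔤 := 𝔤) p) {w : Weil 𝔤}
    (hw : w ∈ Weil.oddPart 𝔤) : (2 : ℂ) • Weil.contraction x w =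
      Weil.right 𝔤 (Cl.ι (x : 𝔤)) * w + w * Weil.right 𝔤 (Cl.ι (x : 𝔤)) := by
  induction hw using Submodule.span_induction with
  | zero => simp
  | add w w' _ _ hw hw' => rw [map_add, smul_add, hw, hw', mul_add, add_mul]; abel
  | smul r w _ hw => rw [map_smul, smul_comm, hw, mul_smul_comm, smul_mul_assoc, smul_add]
  | mem w hw =>
    obtain ⟨i, u, hu, c, hc, ha, rfl⟩ := hw
    rw [Weil.contraction, Weil.map_tmul, AlgHom.toLinearMap_apply, Cl.contraction_eq,
      Env.twist_apply p hu, AlgHom.comp_apply, Cl.twist_apply p hc, map_smul, ha]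
    have h1 := Weil.right_mul_left hu (Cl.ι_mem x.2)
    simp only [Weil.tmul_eq, map_sub, map_mul, map_smul, mul_sub, map_neg, mul_neg, neg_mul,
      smul_neg, smul_mul_assoc, mul_smul_comm, smul_smul, smul_sub]
    rw [← mul_assoc (Weil.right 𝔤 (Cl.ι (x : 𝔤))), h1, smul_mul_assoc]
    simp only [mul_assoc]
    rcases sgn_eq p i with h | h <;> rw [h] <;> module

end Commutators

/-! ### Elements annihilated by the contractions with `𝔩` -/

namespace QuadraticSubalgebra

variable {𝔤 : Type*} [AddCommGroup 𝔤] [Module ℂ 𝔤] [QuadraticLieSuperalgebra 𝔤]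
  (𝔩 : QuadraticSubalgebra 𝔤)

theorem parity_coe (x : 𝔩.toSubmodule) : parity 𝔤 (x : 𝔤) = (parity 𝔩.toSubmodule x : 𝔤) := by
  induction x using par_induction with
  | hadd x y hx hy => rw [Submodule.coe_add, map_add, map_add, hx, hy, Submodule.coe_add]
  | hpar i x hx =>
    rw [parity_apply (x := (x : 𝔤)) hx, parity_apply hx, Submodule.coe_smul]

theorem twist_coe (p : ZMod 2) (x : 𝔩.toSubmodule) :
    twist 𝔤 p (x : 𝔤) = (twist 𝔩.toSubmodule p x : 𝔤) := by
  rcases zmod2_cases p with rfl | rfl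
  · simp [twist]
  · simpa [twist] using 𝔩.parity_coe x

/-- Supersymmetry of the form without homogeneity assumptions. -/
theorem _root_.SuperWeil.form_parity (x y : 𝔤) : form x (parity 𝔤 y) = form y x := by
  induction x using par_induction with
  | hadd x z hx hz => rw [map_add, LinearMap.add_apply, hx, hz, map_add]
  | hpar i x hx =>
    induction y using par_induction with
    | hadd y z hy hz => rw [map_add, map_add, hy, hz, map_add, LinearMap.add_apply]
    | hpar j y hy =>
      rw [parity_apply hy, map_smul, form_supersymm hy hx, smul_eq_mul]
      by_cases h : i = j
      · rw [h, sgn_one_eq_self]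
      · rw [form_consistent hx hy h, mul_zero, mul_zero]

theorem mem_orth_of_form_right {y : 𝔤} (h : ∀ x ∈ 𝔩.toSubmodule, form y x = 0) :
    y ∈ 𝔩.orth := by
  intro x hx
  rw [← form_parity, 𝔩.parity_coe ⟨x, hx⟩]
  exact h _ (Subtype.mem _)

/-- `𝔭` is graded because `𝔩` is graded and the form is even. -/
theorem exists_orth_par_add {y : 𝔤} (hy : y ∈ 𝔩.orth) :
    ∃ y₀ ∈ 𝔩.orth ⊓ par 0, ∃ y₁ ∈ 𝔩.orth ⊓ par 1, y = y₀ + y₁ := by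
  obtain ⟨y₀, h₀, y₁, h₁, rfl⟩ := exists_par_add y
  have key : ∀ i j : ZMod 2, i ≠ j → ∀ u ∈ par (𝔤 := 𝔤) i, ∀ v ∈ par (𝔤 := 𝔤) j,
      u + v ∈ 𝔩.orth → u ∈ 𝔩.orth := by
    intro i j hij u hu v hv huv x hx
    obtain ⟨x, rfl⟩ : ∃ z : 𝔩.toSubmodule, (z : 𝔤) = x := ⟨⟨x, hx⟩, rfl⟩
    clear hx
    induction x using par_induction with
    | hadd x z hx hz =>
      rw [Submodule.coe_add, map_add, LinearMap.add_apply, hx, hz, add_zero]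
    | hpar k x hxk =>
      by_cases hk : k = i
      · have h := huv x x.2
        rwa [map_add, form_consistent (x := (x : 𝔤)) hxk hv (by rw [hk]; exact hij),
          add_zero] at h
      · exact form_consistent (x := (x : 𝔤)) hxk hu hk
  refine ⟨y₀, ⟨key 0 1 (by decide) y₀ h₀ y₁ h₁ hy, h₀⟩, y₁,
    ⟨key 1 0 (by decide) y₁ h₁ y₀ h₀ (by rwa [add_comm]), h₁⟩, rfl⟩

theorem orth_induction {P : 𝔤 → Prop} (hadd : ∀ x y, P x → P y → P (x + y))
    (hpar : ∀ (i : ZMod 2) (x : 𝔤), x ∈ 𝔩.orth → x ∈ par i → P x) {x : 𝔤} (hx : x ∈ 𝔩.orth) :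
    P x := by
  obtain ⟨y, hy, z, hz, rfl⟩ := 𝔩.exists_orth_par_add hx
  exact hadd _ _ (hpar 0 y hy.1 hy.2) (hpar 1 z hz.1 hz.2)

/-! ### The filtration by factors from `𝔩` and its number operator. -/

/-- The subalgebra `Cl(𝔭)` of `Cl(𝔤)` generated by `𝔭 = 𝔩^⊥`. -/
def clOrth : Subalgebra ℂ (Cl 𝔤) := Algebra.adjoin ℂ (Cl.ι '' (𝔩.orth : Set 𝔤))

theorem ι_mem_clOrth {y : 𝔤} (hy : y ∈ 𝔩.orth) : Cl.ι y ∈ 𝔩.clOrth :=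
  Algebra.subset_adjoin ⟨y, hy, rfl⟩

/-- The image of `𝔩` in `Cl(𝔤)`. -/
noncomputable def clGen : Submodule ℂ (Cl 𝔤) := 𝔩.toSubmodule.map Cl.ι

/-- The filtration of `Cl(𝔤)` by the number of factors from `𝔩`. -/
noncomputable def filt : ℕ → Submodule ℂ (Cl 𝔤)
  | 0 => 𝔩.clOrth.toSubmodule
  | k + 1 => filt k ⊔ 𝔩.clGen * filt k

theorem filt_le_succ (k : ℕ) : 𝔩.filt k ≤ 𝔩.filt (k + 1) := le_sup_left

theorem filt_mono : Monotone 𝔩.filt := monotone_nat_of_le_succ 𝔩.filt_le_succ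

theorem ι_mul_mem_filt (x : 𝔩.toSubmodule) {k : ℕ} {m : Cl 𝔤} (hm : m ∈ 𝔩.filt k) :
    Cl.ι (x : 𝔤) * m ∈ 𝔩.filt (k + 1) :=
  Submodule.mem_sup_right (Submodule.mul_mem_mul ⟨x, x.2, rfl⟩ hm)

/-- An additive property of `filt (k + 1)` may be checked on `filt k` and on products of a
homogeneous element of `𝔩` with an element of `filt k`. -/
theorem filt_succ_induction {k : ℕ} {P : Cl 𝔤 → Prop} (hadd : ∀ m n, P m → P n → P (m + n))
    (hmem : ∀ m ∈ 𝔩.filt k, P m)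
    (hmul : ∀ (i : ZMod 2) (x : 𝔩.toSubmodule), x ∈ par i → ∀ m ∈ 𝔩.filt k,
      P (Cl.ι (x : 𝔤) * m))
    {m : Cl 𝔤} (hm : m ∈ 𝔩.filt (k + 1)) : P m := by
  obtain ⟨m', hm', n, hn, rfl⟩ := Submodule.mem_sup.1 hm
  clear hm
  refine hadd _ _ (hmem m' hm') ?_
  clear hm'
  induction hn using Submodule.mul_induction_on' with
  | mem_mul_mem c hc m hm =>
    obtain ⟨x, hx, rfl⟩ := hc
    obtain ⟨x, rfl⟩ : ∃ z : 𝔩.toSubmodule, (z : 𝔤) = x := ⟨⟨x, hx⟩, rfl⟩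
    clear hx
    induction x using par_induction with
    | hadd x y hx hy =>
      rw [Submodule.coe_add, map_add, add_mul]
      exact hadd _ _ hx hy
    | hpar i x hx => exact hmul i x hx m hm
  | add m _ n _ hm hn => exact hadd _ _ hm hn

/-- As `B(𝔩,𝔭) = 0`, an element of `𝔭` passes the factors from `𝔩` with only a sign and is absorbed
into `Cl(𝔭)`. -/
theorem orth_mul_mem_filt {y : 𝔤} (hy : y ∈ 𝔩.orth) {k : ℕ} {m : Cl 𝔤} (hm : m ∈ 𝔩.filt k) :
    Cl.ι y * m ∈ 𝔩.filt k := by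
  refine 𝔩.orth_induction (P := fun y => Cl.ι y * m ∈ 𝔩.filt k)
    (fun x y hx hy => by rw [map_add, add_mul]; exact add_mem hx hy) (fun i y hy hyi => ?_) hy
  induction k generalizing m with
  | zero => exact 𝔩.clOrth.mul_mem (𝔩.ι_mem_clOrth hy) hm
  | succ k ih =>
    refine 𝔩.filt_succ_induction (P := fun m => Cl.ι y * m ∈ 𝔩.filt (k + 1))
      (fun m n hm hn => by rw [mul_add]; exact add_mem hm hn)
      (fun m hm => 𝔩.filt_le_succ k (ih hm)) (fun j x hx m hm => ?_) hm
    have h := Cl.ι_mul_ι_eq (x := (x : 𝔤)) hx hyi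
    rw [hy x x.2, mul_zero, zero_smul, zero_sub] at h
    have h' : Cl.ι y * Cl.ι (x : 𝔤) = -(sgn j i • (Cl.ι (x : 𝔤) * Cl.ι y)) := by
      rw [h, smul_neg, smul_smul, sgn_mul_self, one_smul, neg_neg]
    rw [← mul_assoc, h', neg_mul, smul_mul_assoc, mul_assoc]
    exact neg_mem (Submodule.smul_mem _ _ (𝔩.ι_mul_mem_filt x (ih hm)))

variable {J : Type*} [Fintype J] (f : HomogeneousBasis 𝔩.toSubmodule J)

theorem sum_form_smul_dual_coe (x : 𝔩.toSubmodule) :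
    ∑ a, form (f.e a : 𝔤) (x : 𝔤) • (f.dual a : 𝔤) = x := by
  have h := congrArg Subtype.val (f.sum_form_smul_dual x)
  rw [Submodule.coe_sum] at h
  exact h

/-- The orthogonal projection along `𝔩`. -/
theorem sub_sum_mem_orth (y : 𝔤) :
    y - ∑ a, form y (f.dual a : 𝔤) • (f.e a : 𝔤) ∈ 𝔩.orth := by
  refine 𝔩.mem_orth_of_form_right fun x hx => ?_
  have h := 𝔩.sum_form_smul_dual_coe f ⟨x, hx⟩
  dsimp only at h
  rw [map_sub, LinearMap.sub_apply, sub_eq_zero]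
  conv_lhs => rw [← h]
  simp [LinearMap.sum_apply, mul_comm]

theorem exists_mem_filt {J : Type*} [Fintype J] (f : HomogeneousBasis 𝔩.toSubmodule J)
    (c : Cl 𝔤) : ∃ k, c ∈ 𝔩.filt k := by
  -- The union of the filtration is stable under left multiplication by `𝔤 = 𝔩 + 𝔭`; then apply this
  -- to `1`, which lies in step `0`.
  have key : ∀ c : Cl 𝔤, ∀ k, ∀ m ∈ 𝔩.filt k, ∃ l, c * m ∈ 𝔩.filt l := by
    intro c
    have hc : c ∈ Algebra.adjoin ℂ (Set.range (Cl.ι (𝔤 := 𝔤))) := by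
      rw [Cl.adjoin_range_ι]; exact Algebra.mem_top
    induction hc using Algebra.adjoin_induction with
    | mem c hc =>
      obtain ⟨y, rfl⟩ := hc
      intro k m hm
      refine ⟨k + 1, ?_⟩
      rw [← sub_add_cancel y (∑ a, form y (f.dual a : 𝔤) • (f.e a : 𝔤)), map_add, add_mul]
      refine add_mem (𝔩.filt_le_succ k (𝔩.orth_mul_mem_filt (𝔩.sub_sum_mem_orth f y) hm)) ?_
      have h := 𝔩.ι_mul_mem_filt (∑ a, form y (f.dual a : 𝔤) • f.e a) hm
      rwa [Submodule.coe_sum] at h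
    | algebraMap r =>
      intro k m hm
      exact ⟨k, by rw [← Algebra.smul_def]; exact Submodule.smul_mem _ _ hm⟩
    | add c d _ _ hc hd =>
      intro k m hm
      obtain ⟨l, hl⟩ := hc k m hm
      obtain ⟨l', hl'⟩ := hd k m hm
      exact ⟨max l l', by
        rw [add_mul]
        exact add_mem (𝔩.filt_mono (le_max_left _ _) hl) (𝔩.filt_mono (le_max_right _ _) hl')⟩
    | mul c d _ _ hc hd =>
      intro k m hm
      obtain ⟨l, hl⟩ := hd k m hm
      obtain ⟨l', hl'⟩ := hc l _ hl
      exact ⟨l', by rwa [mul_assoc]⟩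
  obtain ⟨l, hl⟩ := key c 0 1 𝔩.clOrth.one_mem
  exact ⟨l, by rwa [mul_one] at hl⟩

theorem contraction_filt_zero {p : ZMod 2} (x : par (𝔤 := 𝔤) p) (hx : (x : 𝔤) ∈ 𝔩.toSubmodule)
    {m : Cl 𝔤} (hm : m ∈ 𝔩.filt 0) : Cl.contraction x m = 0 := by
  have hm' : m ∈ Algebra.adjoin ℂ (Cl.ι '' (𝔩.orth : Set 𝔤)) := hm
  rw [Cl.contraction_eq, sub_eq_zero]
  refine adjoin_intertwine (f := AlgHom.id ℂ _) ?_ hm'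
  rintro _ ⟨y, hy, rfl⟩
  have h := Cl.contraction_ι x y
  rwa [hy _ hx, zero_smul, Cl.contraction_eq, sub_eq_zero] at h

/-- A contraction with `𝔩` can only remove a factor from `𝔩`. At `k = 0` the truncated `k - 1` loses
nothing, since there the contraction vanishes by `contraction_filt_zero`. -/
theorem contraction_mem_filt {p : ZMod 2} (x : par (𝔤 := 𝔤) p) (hx : (x : 𝔤) ∈ 𝔩.toSubmodule)
    {k : ℕ} {m : Cl 𝔤} (hm : m ∈ 𝔩.filt k) : Cl.contraction x m ∈ 𝔩.filt (k - 1) := by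
  induction k generalizing m with
  | zero => rw [𝔩.contraction_filt_zero x hx hm]; exact zero_mem _
  | succ k ih =>
    refine 𝔩.filt_succ_induction (P := fun m => Cl.contraction x m ∈ 𝔩.filt k)
      (fun m n hm hn => by rw [map_add]; exact add_mem hm hn)
      (fun m hm => 𝔩.filt_mono (Nat.sub_le k 1) (ih hm)) (fun j y hy m hm => ?_) hm
    rw [Cl.contraction_ι_mul, twist_coe]
    refine sub_mem (Submodule.smul_mem _ _ hm) ?_
    rcases k with _ | k
    · rw [𝔩.contraction_filt_zero x hx hm, mul_zero]; exact zero_mem _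
    · exact 𝔩.ι_mul_mem_filt _ (ih hm)

/-- The operator counting, up to lower order terms, the factors from `𝔩`. -/
noncomputable def number : Cl 𝔤 →ₗ[ℂ] Cl 𝔤 :=
  ∑ a, LinearMap.mulLeft ℂ (Cl.ι (f.dual a : 𝔤)) ∘ₗ
    Cl.contraction (⟨(f.e a : 𝔤), f.mem a⟩ : par (𝔤 := 𝔤) (f.deg a))

theorem number_apply (c : Cl 𝔤) : 𝔩.number f c = ∑ a, Cl.ι (f.dual a : 𝔤) *
    Cl.contraction (⟨(f.e a : 𝔤), f.mem a⟩ : par (𝔤 := 𝔤) (f.deg a)) c := by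
  simp [number]

/-- By the Leibniz rule a new factor `y ∈ 𝔩` is counted once, through `∑ B(f_a,y) fᵃ = y`.
Exchanging `fᵃ` with `y` costs only contractions of `m`, which are of lower order. -/
theorem number_sub_smul_mem {k : ℕ} {m : Cl 𝔤} (hm : m ∈ 𝔩.filt k) :
    𝔩.number f m - (k : ℂ) • m ∈ 𝔩.filt (k - 1) := by
  induction k generalizing m with
  | zero =>
    rw [number_apply, Finset.sum_eq_zero fun a _ => by
      rw [𝔩.contraction_filt_zero _ (f.e a).2 hm, mul_zero], Nat.cast_zero, zero_smul, sub_zero]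
    exact zero_mem _
  | succ k ih =>
    refine 𝔩.filt_succ_induction
      (P := fun m => 𝔩.number f m - ((k + 1 : ℕ) : ℂ) • m ∈ 𝔩.filt k)
      (fun m n hm hn => by
        rw [map_add, smul_add, add_sub_add_comm]; exact add_mem hm hn)
      (fun m hm => ?_) (fun j y hy m hm => ?_) hm
    · have h := sub_mem (𝔩.filt_mono (Nat.sub_le k 1) (ih hm)) hm
      convert! h using 1
      push_cast
      module
    · have key : ∀ a, Cl.ι (f.dual a : 𝔤) *
          Cl.contraction (⟨(f.e a : 𝔤), f.mem a⟩ : par (𝔤 := 𝔤) (f.deg a)) (Cl.ι (y : 𝔤) * m) =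
          Cl.ι (form (f.e a : 𝔤) (y : 𝔤) • (f.dual a : 𝔤)) * m +
          Cl.ι (y : 𝔤) * (Cl.ι (f.dual a : 𝔤) *
            Cl.contraction (⟨(f.e a : 𝔤), f.mem a⟩ : par (𝔤 := 𝔤) (f.deg a)) m) -
          (2 * sgn (f.deg a) j * form (f.dual a : 𝔤) (y : 𝔤)) •
            Cl.contraction (⟨(f.e a : 𝔤), f.mem a⟩ : par (𝔤 := 𝔤) (f.deg a)) m := by
        intro a
        have h := Cl.ι_mul_ι_eq (x := (f.dual a : 𝔤)) (y := (y : 𝔤)) (f.dual_mem a) hy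
        rw [Cl.contraction_ι_mul, twist_apply (f.deg a) (x := (y : 𝔤)) hy, map_smul, map_smul,
          mul_sub, mul_smul_comm, smul_mul_assoc, smul_mul_assoc, mul_smul_comm, ← mul_assoc, h,
          sub_mul, smul_one_mul, smul_sub, smul_mul_assoc, smul_smul, smul_smul, sgn_mul_self,
          mul_assoc]
        module
      have hN : 𝔩.number f (Cl.ι (y : 𝔤) * m) - ((k + 1 : ℕ) : ℂ) • (Cl.ι (y : 𝔤) * m) =
          Cl.ι (y : 𝔤) * (𝔩.number f m - (k : ℂ) • m) -
          ∑ a, (2 * sgn (f.deg a) j * form (f.dual a : 𝔤) (y : 𝔤)) •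
            Cl.contraction (⟨(f.e a : 𝔤), f.mem a⟩ : par (𝔤 := 𝔤) (f.deg a)) m := by
        rw [number_apply, Finset.sum_congr rfl fun a _ => key a, Finset.sum_sub_distrib,
          Finset.sum_add_distrib, ← Finset.sum_mul, ← Finset.mul_sum, ← map_sum,
          𝔩.sum_form_smul_dual_coe f,
          ← number_apply, mul_sub, mul_smul_comm]
        push_cast
        module
      rw [hN]
      refine sub_mem ?_ (Submodule.sum_mem _ fun a _ => Submodule.smul_mem _ _
        (𝔩.filt_mono (Nat.sub_le k 1) (𝔩.contraction_mem_filt _ (f.e a).2 hm)))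
      -- For `k = 0` the truncated index `k - 1` is too weak to absorb the factor `y`, so the exact
      -- vanishing of the number operator on `Cl(𝔭)` is used.
      rcases k with _ | k
      · have h0 : 𝔩.number f m = 0 := by
          rw [number_apply]
          exact Finset.sum_eq_zero fun a _ => by
            rw [𝔩.contraction_filt_zero _ (f.e a).2 hm, mul_zero]
        rw [h0, Nat.cast_zero, zero_smul, sub_zero, mul_zero]
        exact zero_mem _
      · exact 𝔩.ι_mul_mem_filt y (ih hm)

/-- Elements of `Cl(𝔤)` annihilated by the contractions with `𝔩` lie in `Cl(𝔭)`. -/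
theorem mem_clOrth_of_contraction {J : Type*} [Fintype J]
    (f : HomogeneousBasis 𝔩.toSubmodule J) {c : Cl 𝔤} (h : ∀ (p : ZMod 2) (x : par (𝔤 := 𝔤) p),
      (x : 𝔤) ∈ 𝔩.toSubmodule → Cl.contraction x c = 0) : c ∈ 𝔩.clOrth := by
  obtain ⟨k, hk⟩ := 𝔩.exists_mem_filt f c
  have h0 : 𝔩.number f c = 0 := by
    rw [number_apply]
    exact Finset.sum_eq_zero fun a _ => by rw [h _ _ (f.e a).2, mul_zero]
  induction k with
  | zero => exact hk
  | succ k ih =>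
    refine ih ?_
    -- The number operator kills `c`, yet acts as `k + 1` modulo the previous step; dividing by `k +
    -- 1` lowers the filtration.
    have h1 := 𝔩.number_sub_smul_mem f hk
    rw [h0, zero_sub, neg_mem_iff] at h1
    exact (Submodule.smul_mem_iff _ (Nat.cast_ne_zero.2 k.succ_ne_zero)).1 h1

end QuadraticSubalgebra

/-! ### The relative Dirac operator is basic -/

namespace QuadraticSubalgebra

variable {𝔤 : Type*} [AddCommGroup 𝔤] [Module ℂ 𝔤] [QuadraticLieSuperalgebra 𝔤]
  (𝔩 : QuadraticSubalgebra 𝔤)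

theorem clMap_mem {i : ZMod 2} {c : Cl 𝔩.toSubmodule} (hc : c ∈ Cl.grading 𝔩.toSubmodule i) :
    𝔩.clMap c ∈ Cl.grading 𝔤 i := by
  have h : Cl.parity.comp 𝔩.clMap = 𝔩.clMap.comp Cl.parity := Cl.hom_ext fun x => by
    simp only [AlgHom.comp_apply, Cl.parity, Cl.lift_ι, clMap_ι, LinearMap.comp_apply, parity_coe]
  have h' := AlgHom.congr_fun h c
  rw [AlgHom.comp_apply, AlgHom.comp_apply, mem_eig.1 hc, map_smul] at h'
  exact h'

theorem alt_clMap (c : Cl 𝔩.toSubmodule) : Cl.alt 𝔤 (𝔩.clMap c) = 𝔩.clMap (Cl.alt _ c) :=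
  AlgHom.congr_fun (Cl.hom_ext (f := (Cl.alt 𝔤).comp 𝔩.clMap) (g := 𝔩.clMap.comp (Cl.alt _))
    fun x => by simp) c

variable {I J : Type*} [Fintype I] [Fintype J] (e : HomogeneousBasis 𝔤 I)
  (f : HomogeneousBasis 𝔩.toSubmodule J)

/-- The Clifford component of the image of `x ⊗ 1` under the canonical map. -/
noncomputable def spinDiff : 𝔩.toSubmodule →ₗ[ℂ] Cl 𝔤 :=
  (-(1 / 2) : ℂ) • e.gamma ∘ₗ 𝔩.toSubmodule.subtype + (1 / 2 : ℂ) • 𝔩.clMap.toLinearMap ∘ₗ f.gamma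

theorem spinDiff_apply (x : 𝔩.toSubmodule) : 𝔩.spinDiff e f x =
    (-(1 / 2) : ℂ) • e.gamma (x : 𝔤) + (1 / 2 : ℂ) • 𝔩.clMap (f.gamma x) := rfl

theorem spinDiff_mem {p : ZMod 2} {x : 𝔩.toSubmodule} (hx : x ∈ par p) :
    𝔩.spinDiff e f x ∈ Cl.grading 𝔤 p :=
  add_mem (Submodule.smul_mem _ _ (e.gamma_mem (x := (x : 𝔤)) hx))
    (Submodule.smul_mem _ _ (𝔩.clMap_mem (f.gamma_mem hx)))

theorem alt_spinDiff (x : 𝔩.toSubmodule) :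
    Cl.alt 𝔤 (𝔩.spinDiff e f x) = 𝔩.spinDiff e f x := by
  rw [spinDiff_apply, map_add, map_smul, map_smul, e.alt_gamma, alt_clMap, f.alt_gamma]

theorem spinDiff_mul_ι {p i : ZMod 2} {x y : 𝔩.toSubmodule} (hx : x ∈ par p) (hy : y ∈ par i) :
    𝔩.spinDiff e f x * Cl.ι (y : 𝔤) = sgn p i • (Cl.ι (y : 𝔤) * 𝔩.spinDiff e f x) := by
  have h1 := e.gamma_mul_ι (x := (x : 𝔤)) (y := (y : 𝔤)) hx hy
  have h2 := congrArg 𝔩.clMap (f.gamma_mul_ι hx hy)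
  rw [map_mul, map_sub, map_smul, map_smul, map_mul, clMap_ι, clMap_ι] at h2
  rw [spinDiff_apply, add_mul, smul_mul_assoc, smul_mul_assoc, h1, h2, mul_add, mul_smul_comm,
    mul_smul_comm]
  change _ • (_ - (2 : ℂ) • Cl.ι ((bracket x y : 𝔩.toSubmodule) : 𝔤)) + _ = _
  module

/-- The Clifford component of the relative Dirac operator. -/
noncomputable def relCubic : Cl 𝔤 :=
  e.phiPrime - (∑ a, 𝔩.spinDiff e f (f.dual a) * Cl.ι (f.e a : 𝔤) + 𝔩.clMap f.phiPrime)

theorem sum_spinDiff_mul_mem :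
    ∑ a, 𝔩.spinDiff e f (f.dual a) * Cl.ι (f.e a : 𝔤) + 𝔩.clMap f.phiPrime ∈ Cl.grading 𝔤 0 := by
  refine add_mem (Submodule.sum_mem _ fun a _ => ?_) (𝔩.clMap_mem f.phiPrime_mem)
  have h := SetLike.mul_mem_graded (𝔩.spinDiff_mem e f (f.dual_mem a))
    (Cl.ι_mem (x := (f.e a : 𝔤)) (f.mem a))
  rwa [CharTwo.add_self_eq_zero] at h

theorem alt_sum_spinDiff_mul :
    Cl.alt 𝔤 (∑ a, 𝔩.spinDiff e f (f.dual a) * Cl.ι (f.e a : 𝔤) + 𝔩.clMap f.phiPrime) =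
      -(∑ a, 𝔩.spinDiff e f (f.dual a) * Cl.ι (f.e a : 𝔤) + 𝔩.clMap f.phiPrime) := by
  simp only [map_add, map_sum, map_mul, alt_spinDiff, Cl.alt_ι, alt_clMap, f.alt_phiPrime, map_neg,
    mul_neg, Finset.sum_neg_distrib, neg_add]

theorem relCubic_mem : 𝔩.relCubic e f ∈ Cl.grading 𝔤 0 :=
  sub_mem e.phiPrime_mem (𝔩.sum_spinDiff_mul_mem e f)

theorem alt_relCubic : Cl.alt 𝔤 (𝔩.relCubic e f) = -𝔩.relCubic e f := by
  rw [relCubic, map_sub, e.alt_phiPrime, alt_sum_spinDiff_mul, neg_sub_neg, neg_sub]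

/-- The defects from anticommuting with `x` are `-γ'_𝔤(x)` from `φ'_𝔤`, `2 spinDiff(x) = -γ'_𝔤(x) +
γ'_𝔩(x)` from the middle sum and `-γ'_𝔩(x)` from `φ'_𝔩`; the first minus the other two is zero. -/
theorem relCubic_mul_ι {p : ZMod 2} {x : 𝔩.toSubmodule} (hx : x ∈ par p) :
    𝔩.relCubic e f * Cl.ι (x : 𝔤) = -(Cl.ι (x : 𝔤) * 𝔩.relCubic e f) := by
  have h1 := congrArg 𝔩.clMap (f.phiPrime_mul_ι x)
  rw [map_mul, map_sub, map_neg, map_mul, clMap_ι] at h1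
  have key : ∀ a, 𝔩.spinDiff e f (f.dual a) * Cl.ι (f.e a : 𝔤) * Cl.ι (x : 𝔤) =
      (2 : ℂ) • 𝔩.spinDiff e f (form (f.e a) x • f.dual a) -
        Cl.ι (x : 𝔤) * (𝔩.spinDiff e f (f.dual a) * Cl.ι (f.e a : 𝔤)) := by
    intro a
    rw [mul_assoc, Cl.ι_mul_ι_eq (x := (f.e a : 𝔤)) (y := (x : 𝔤)) (f.mem a) hx, mul_sub,
      mul_smul_comm, mul_smul_comm, mul_one, ← mul_assoc, 𝔩.spinDiff_mul_ι e f (f.dual_mem a) hx,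
      smul_mul_assoc, smul_smul, sgn_mul_self, one_smul, mul_assoc, map_smul, smul_smul]
    rfl
  rw [relCubic, sub_mul, add_mul, Finset.sum_mul, Finset.sum_congr rfl fun a _ => key a,
    Finset.sum_sub_distrib, ← Finset.smul_sum, ← map_sum, f.sum_form_smul_dual, h1,
    e.phiPrime_mul_ι, spinDiff_apply, ← Finset.mul_sum, mul_sub, mul_add]
  module

/-- On an element of even parity and odd length the contraction is half the anticommutator, which
vanishes by `relCubic_mul_ι`. -/
theorem relCubic_mem_clOrth : 𝔩.relCubic e f ∈ 𝔩.clOrth := by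
  refine 𝔩.mem_clOrth_of_contraction f fun p x hx => ?_
  have h := 𝔩.relCubic_mul_ι e f (x := ⟨x, hx⟩) (p := p) x.2
  rw [Cl.contraction_eq, AlgHom.comp_apply, Cl.twist_apply p (𝔩.relCubic_mem e f), map_smul,
    alt_relCubic, smul_mul_assoc, mul_smul_comm, smul_neg, neg_mul, smul_mul_assoc, h]
  simp [sgn]

variable {𝔩 e f} {j : Weil 𝔩.toSubmodule →ₐ[ℂ] Weil 𝔤}

theorem IsCanonicalMap.map_dirac (hj : 𝔩.IsCanonicalMap e f j) : j f.dirac =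
    ∑ a, Weil.tmul (Env.ι (f.dual a : 𝔤)) (Cl.ι (f.e a : 𝔤)) +
      Weil.right 𝔤 (∑ a, 𝔩.spinDiff e f (f.dual a) * Cl.ι (f.e a : 𝔤) + 𝔩.clMap f.phiPrime) := by
  have h : ∀ x, j (Weil.left _ (Env.ι x)) =
      Weil.left 𝔤 (Env.ι (x : 𝔤)) + Weil.right 𝔤 (𝔩.spinDiff e f x) := by
    intro x
    rw [hj.left_ι, e.gammaW_apply, spinDiff_apply, map_add, map_smul _ (1 / 2 : ℂ), add_assoc]
  rw [f.dirac_eq, map_add, hj.right, map_add, ← add_assoc, map_sum, map_sum,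
    ← Finset.sum_add_distrib]
  congr 1
  refine Finset.sum_congr rfl fun a _ => ?_
  rw [map_mul, h, hj.right_ι, add_mul, Weil.tmul_eq, map_mul]

theorem IsCanonicalMap.relDirac_mem_oddPart (hj : 𝔩.IsCanonicalMap e f j) :
    relDirac e f j ∈ Weil.oddPart 𝔤 := by
  rw [relDirac, hj.map_dirac, HomogeneousBasis.dirac]
  exact sub_mem
    (add_mem (Submodule.sum_mem _ fun a _ => Weil.tmul_mem_oddPart (Env.ι_mem (e.dual_mem a))
      (Cl.ι_mem (e.mem a)) (Cl.alt_ι _)) (Weil.right_mem_oddPart e.phiPrime_mem e.alt_phiPrime))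
    (add_mem (Submodule.sum_mem _ fun a _ => Weil.tmul_mem_oddPart
        (Env.ι_mem (x := (f.dual a : 𝔤)) (f.dual_mem a))
        (Cl.ι_mem (x := (f.e a : 𝔤)) (f.mem a)) (Cl.alt_ι _))
      (Weil.right_mem_oddPart (𝔩.sum_spinDiff_mul_mem e f) (𝔩.alt_sum_spinDiff_mul e f)))

/-- The subtracted linear part replaces each `eₐ` by its projection to `𝔭`, which makes membership
in `𝔘(𝔤) ⊗ Cl(𝔭)` visible term by term. -/
theorem IsCanonicalMap.relDirac_eq (hj : 𝔩.IsCanonicalMap e f j) : relDirac e f j =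
    ∑ a, Weil.tmul (Env.ι (e.dual a))
        (Cl.ι (e.e a - ∑ c, form (e.e a) (f.dual c : 𝔤) • (f.e c : 𝔤))) +
      Weil.tmul 1 (𝔩.relCubic e f) := by
  -- The canonical tensor of `𝔩` is rewritten in the basis of `𝔤` by expanding `fᶜ = ∑ B(eₐ,fᶜ) eᵃ`.
  have h : ∑ c, Weil.tmul (Env.ι (f.dual c : 𝔤)) (Cl.ι (f.e c : 𝔤)) =
      ∑ a, Weil.tmul (Env.ι (e.dual a))
        (Cl.ι (∑ c, form (e.e a) (f.dual c : 𝔤) • (f.e c : 𝔤))) := by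
    simp only [Weil.tmul_eq, map_sum, map_smul, Finset.mul_sum]
    rw [Finset.sum_comm]
    refine Finset.sum_congr rfl fun c _ => ?_
    conv_lhs => rw [← e.sum_form_smul_dual (f.dual c : 𝔤)]
    simp only [map_sum, map_smul, Finset.sum_mul, smul_mul_assoc, mul_smul_comm]
  rw [relDirac, hj.map_dirac, e.dirac_eq, h, relCubic, Weil.one_tmul, map_sub]
  simp only [Weil.tmul_eq, map_sub, mul_sub, Finset.sum_sub_distrib]
  abel

theorem IsCanonicalMap.relDirac_mem_relWeil (hj : 𝔩.IsCanonicalMap e f j) :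
    relDirac e f j ∈ 𝔩.relWeil := by
  refine ⟨?_, ?_⟩
  · rw [hj.relDirac_eq]
    exact add_mem (Submodule.sum_mem _ fun a _ => Submodule.subset_span
      ⟨_, _, 𝔩.ι_mem_clOrth (𝔩.sub_sum_mem_orth f (e.e a)), rfl⟩)
      (Submodule.subset_span ⟨_, _, 𝔩.relCubic_mem_clOrth e f, rfl⟩)
  · simp only [SetLike.mem_coe, Submodule.mem_iInf]
    intro p x hx
    refine ⟨?_, ?_⟩
    · have h := hj.gammaW_mul_relDirac ⟨x, hx⟩
      rw [SetLike.mem_coe, LinearMap.mem_ker, Weil.lieDer_eq e x hj.relDirac_mem_oddPart]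
      exact sub_eq_zero.2 h
    · have h := hj.relDirac_mul_right ⟨x, hx⟩
      have h2 := Weil.two_smul_contraction x hj.relDirac_mem_oddPart
      rw [h, add_neg_cancel] at h2
      exact (smul_eq_zero.1 h2).resolve_left two_ne_zero

end QuadraticSubalgebra

end SuperWeil

theorem mainTheorem7 {𝔤 : Type*} [AddCommGroup 𝔤] [Module ℂ 𝔤]
    [SuperWeil.QuadraticLieSuperalgebra 𝔤] (𝔩 : SuperWeil.QuadraticSubalgebra 𝔤)
    {I J : Type*} [Fintype I] [Fintype J]
    (e : SuperWeil.HomogeneousBasis 𝔤 I) (f : SuperWeil.HomogeneousBasis 𝔩.toSubmodule J) :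
    ∃ j : SuperWeil.Weil 𝔩.toSubmodule →ₐ[ℂ] SuperWeil.Weil 𝔤,
      𝔩.IsCanonicalMap e f j ∧
      (∀ j' : SuperWeil.Weil 𝔩.toSubmodule →ₐ[ℂ] SuperWeil.Weil 𝔤,
        𝔩.IsCanonicalMap e f j' → j' = j) ∧
      SuperWeil.relDirac e f j ∈ 𝔩.relWeil ∧
      SuperWeil.relDirac e f j ^ 2 =
        SuperWeil.Weil.tmul e.casimir 1 - j (SuperWeil.Weil.tmul f.casimir 1) +
          algebraMap ℂ (SuperWeil.Weil 𝔤) ((1 / 24) * e.strCasimir) -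
          algebraMap ℂ (SuperWeil.Weil 𝔤) ((1 / 24) * f.strCasimir) := by
  have hj := 𝔩.isCanonicalMap_canonicalMap e f
  exact ⟨_, hj, fun _ hj' => hj.unique hj', hj.relDirac_mem_relWeil, hj.relDirac_sq⟩
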